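/- For $\varepsilon\in\mathbb R$ let $\mathcal W=\mathcal W(\varepsilon)$ be the unital associative $\mathbb C$-algebra generated by $a_+,a_-,b_+,b_-$ with the relations $[a_-,a_+]=\varepsilon$, $[b_-,b_+]=\varepsilon$, and every $a_\pm$ commuting with every $b_\pm$. Let $S(s,t,u,v)$ be the sum of all distinct rearrangements of the word $a_-^s a_+^t b_-^u b_+^v$, each with coefficient $1$; these elements form a basis of $\mathcal W(\varepsilon)$, through which all $\mathcal W(\varepsilon)$ are identified with one vector space (that of totally symmetric polynomials). Put $$J_0=\tfrac12(a_+a_--b_+b_-),\quad J_+=a_+b_-,\quad J_-=a_-b_+,\quad K_0=\tfrac12(a_+a_-+b_+b_-+\varepsilon).$$ Let $\dagger$ be the conjugate-linear anti-automorphism of $\mathcal W$ with $a_\pm^\dagger=a_\mp$, $b_\pm^\dagger=b_\mp$. The formal trace $\mathrm{tr}:\mathcal W\to\mathcal W$ is the linear map defined by writing $w$ as a totally symmetric polynomial and, in each word, deleting the last two letters if they are $a_+a_-$, $a_-a_+$, $b_+b_-$ or $b_-b_+$, and replacing the word by $0$ otherwise. Let $\Psi=\ker(\mathrm{tr})$ and,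 for $r\in\mathbb R$, $$\Psi_r=\{\xi\in\Psi : \tfrac1\varepsilon[K_0,\xi]=r\,\xi\},$$ where $\tfrac1\varepsilon[K_0,\cdot]$ is continued to $\varepsilon=0$ as the operator which multiplies $S(s,t,u,v)$ by $\tfrac12(t+v-s-u)$, as it does for every $\varepsilon\neq0$. Let $R\ge0$, let $\hat R=(R^2+\tfrac14\varepsilon^2)^{1/2}$, and, unless $\varepsilon\to 0$ is considered, let $\varepsilon\in\mathbb R$ be such that $\hat R>0$. Let $\rho$ and $\rho^\star$ be the projections of $\mathcal W$ onto $\Psi$ with kernels $\{w(K_0-\hat R):w\in\mathcal W\}$ and $\{(K_0-\hat R)w:w\in\mathcal W\}$; they exist, that is, each of these two subspaces is a complement of $\Psi$ in $\mathcal W$. Let $\pi_0(w)\in\mathbb C$ be the coefficient of $S(0,0,0,0)=1$ in $w$, and let $\langle\xi,\zeta\rangle=\pi_0(\rho(\xi^\dagger\zeta))$ for $\xi,\zeta\in\Psi$. Then the following hold. 1. If $f,g,h\in\Psi_0$ then $\rho(fg)\in\Psi_0$, $\rho(\rho(fg)h)=\rho(f\rho(gh))$, $1\in\Psi_0$ and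 $\rho(1f)=\rho(f1)=f$, so that $(\Psi_0,\rho)$ is a unital associative algebra. Moreover $\rho(fg)=\rho^\star(fg)$. 2. Let $\mathcal P(\varepsilon,R)$ be the unital associative $\mathbb C$-algebra generated by $J_+,J_-,J_0$ with the relations $[J_0,J_+]=\varepsilon J_+$, $[J_0,J_-]=-\varepsilon J_-$, $[J_+,J_-]=2\varepsilon J_0$, $J_0^2+\tfrac12J_+J_-+\tfrac12J_-J_+=R^2$. There is an isomorphism of unital algebras from $\mathcal P(\varepsilon,R)$ onto $(\Psi_0,\rho)=(\Psi_0,\rho^\star)$ which sends $J_0,J_+,J_-$ to the elements of $\Psi_0$ of the same name. 3. For all $w_1,w_2\in\mathcal W$, $\rho(w_1\rho(w_2))=\rho(w_1w_2)$. In particular $\rho(\xi_1\rho(\xi_2\xi_3))=\rho(\xi_1\xi_2\xi_3)$ for all $\xi_1,\xi_2,\xi_3\in\Psi$. 4. Fix $R\ge0$ and totally symmetric polynomials $w_1,w_2,w_3$ (independent of $\varepsilon$, in particular arbitrary elements of $\Psi$). As $\varepsilon\to0$, $$\rho(\rho(w_1)w_2)-\rho(w_1w_2)=O(\varepsilon),\qquad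 \rho(\rho(w_1w_2)w_3)-\rho(w_1w_2w_3)=O(\varepsilon),$$ where products and $\rho$ are those belonging to $\varepsilon$ and $R$, and the size of an element of $\mathcal W(\varepsilon)$ is the sum of the absolute values of its coefficients in the basis $S(s,t,u,v)$. 5. If $\xi\in\Psi_{r_1}$ and $\zeta\in\Psi_{r_2}$ then $\xi^\dagger\in\Psi_{-r_1}$ and $\rho(\xi\zeta)\in\Psi_{r_2+r_1}$. 6. $\Psi$ and every $\Psi_r$ are right modules over $(\Psi_0,\rho)$: for $f,g\in\Psi_0$ and $\xi$ in $\Psi$ (respectively $\Psi_r$), the element $\rho(\xi f)$ lies in $\Psi$ (respectively $\Psi_r$), $\rho(\xi 1)=\xi$, and $\rho(\rho(\xi f)g)=\rho(\xi\rho(fg))=\rho(\xi fg)$. 7. The sesquilinear form is Hermitian: $\langle\xi,\zeta\rangle=\overline{\langle\zeta,\xi\rangle}$ for all $\xi,\zeta\in\Psi$. -/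

import Mathlib

open Asymptotics Topology

noncomputable section

namespace FuzzySphere

/-! ## The algebra of two Heisenberg-Weil pairs -/

/-- The four letters `a₋, a₊, b₋, b₊`. -/
inductive Gen where
  | am | ap | bm | bp
  deriving DecidableEq

instance : Fintype Gen where
  elems := {.am, .ap, .bm, .bp}
  complete g := by cases g <;> simp

/-- The exchange `a₊ ↔ a₋`, `b₊ ↔ b₋`. -/
def Gen.conj : Gen → Gen
  | .am => .ap
  | .ap => .am
  | .bm => .bp
  | .bp => .bm

/-- `+1` for the letters `a₊, b₊` and `-1` for the letters `a₋, b₋`. -/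
def Gen.sign : Gen → ℂ
  | .am => -1
  | .ap => 1
  | .bm => -1
  | .bp => 1

/-- Free associative algebra of noncommutative polynomials in `a₋, a₊, b₋, b₊`. -/
abbrev FreeW : Type := FreeAlgebra ℂ Gen

/-- A letter as an element of the free algebra. -/
def letter (g : Gen) : FreeW := FreeAlgebra.ι ℂ g

/-- The relations `[a₋,a₊] = ε`, `[b₋,b₊] = ε`, and every `a` commutes with every `b`. -/
inductive Rel (ε : ℝ) : FreeW → FreeW → Prop
  | aa : Rel ε (letter .am * letter .ap - letter .ap * letter .am) (algebraMap ℂ FreeW (ε : ℂ))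
  | bb : Rel ε (letter .bm * letter .bp - letter .bp * letter .bm) (algebraMap ℂ FreeW (ε : ℂ))
  | mm : Rel ε (letter .am * letter .bm - letter .bm * letter .am) 0
  | mp : Rel ε (letter .am * letter .bp - letter .bp * letter .am) 0
  | pm : Rel ε (letter .ap * letter .bm - letter .bm * letter .ap) 0
  | pp : Rel ε (letter .ap * letter .bp - letter .bp * letter .ap) 0

/-- The algebra `𝒲(ε)`. -/
def W (ε : ℝ) : Type := RingQuot (Rel ε)

instance (ε : ℝ) : Ring (W ε) := inferInstanceAs (Ring (RingQuot (Rel ε)))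

instance (ε : ℝ) : Algebra ℂ (W ε) := inferInstanceAs (Algebra ℂ (RingQuot (Rel ε)))

/-- The quotient map from the free algebra onto `𝒲(ε)`. -/
def toW (ε : ℝ) : FreeW →ₐ[ℂ] W ε := RingQuot.mkAlgHom ℂ (Rel ε)

/-- A letter as an element of `𝒲(ε)`. -/
def gen (ε : ℝ) (g : Gen) : W ε := toW ε (letter g)

/-- The word (product of letters) given by a list. -/
def word (l : List Gen) : FreeW := (l.map letter).prod

/-- The totally symmetric polynomial `S(s,t,u,v)`, where `m` is the multiset with `s` letters `a₋`,
`t` letters `a₊`, `u` letters `b₋`, `v` letters `b₊`: the sum of all distinct rearrangements of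
`m`, each with coefficient 1. -/
def symPoly (m : Multiset Gen) : FreeW := ∑ l ∈ m.lists.toFinset, word l

/-! ### The symmetric polynomials form a basis of `𝒲(ε)` -/

theorem gen_comm (ε : ℝ) (g h : Gen) :
    gen ε g * gen ε h = gen ε h * gen ε g +
      algebraMap ℂ (W ε) (if h = g.conj then -(g.sign) * (ε : ℂ) else 0) := by
  have key : ∀ x y z : FreeW, Rel ε (x - y) z → toW ε x = toW ε y + toW ε z := by
    intro x y z hr
    have := RingQuot.mkAlgHom_rel ℂ hr
    have h2 : toW ε (x - y) = toW ε z := this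
    rw [map_sub] at h2
    rw [← h2]; abel
  have e1 := key _ _ _ (Rel.aa (ε := ε))
  have e2 := key _ _ _ (Rel.bb (ε := ε))
  have e3 := key _ _ _ (Rel.mm (ε := ε))
  have e4 := key _ _ _ (Rel.mp (ε := ε))
  have e5 := key _ _ _ (Rel.pm (ε := ε))
  have e6 := key _ _ _ (Rel.pp (ε := ε))
  simp only [map_mul, map_zero, add_zero, AlgHom.commutes] at e1 e2 e3 e4 e5 e6
  unfold gen
  cases g <;> cases h <;> simp [Gen.conj, Gen.sign, e1, e2, e3, e4, e5, e6]

theorem word_cons (g : Gen) (l : List Gen) : word (g :: l) = letter g * word l := by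
  simp [word]

theorem mem_symPoly (m : Multiset Gen) (l : List Gen) :
    l ∈ m.lists.toFinset ↔ (l : Multiset Gen) = m := by
  rw [Multiset.mem_toFinset, Multiset.mem_lists_iff]
  exact eq_comm

/-- Span in `𝒲(ε)` of the words with at most `n` letters. -/
def filt (ε : ℝ) (n : ℕ) : Submodule ℂ (W ε) :=
  Submodule.span ℂ {x | ∃ l : List Gen, l.length ≤ n ∧ x = toW ε (word l)}

theorem filt_mono (ε : ℝ) {n k : ℕ} (h : n ≤ k) : filt ε n ≤ filt ε k :=
  Submodule.span_mono fun _ ⟨l, hl, hx⟩ => ⟨l, hl.trans h, hx⟩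

theorem gen_mul_filt (ε : ℝ) (g : Gen) (n : ℕ) (x : W ε) (hx : x ∈ filt ε n) :
    gen ε g * x ∈ filt ε (n + 1) := by
  induction hx using Submodule.span_induction with
  | mem x h =>
    obtain ⟨l, hl, rfl⟩ := h
    refine Submodule.subset_span ⟨g :: l, by simpa using hl, ?_⟩
    rw [word_cons, map_mul, gen]
  | zero => simp
  | add x y _ _ hx hy => rw [mul_add]; exact add_mem hx hy
  | smul c x _ hx => rw [mul_smul_comm]; exact Submodule.smul_mem _ _ hx

theorem perm_sub_mem (ε : ℝ) {l₁ l₂ : List Gen} (h : l₁.Perm l₂) :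
    ∀ n, l₁.length ≤ n + 1 → toW ε (word l₁) - toW ε (word l₂) ∈ filt ε n := by
  induction h with
  | nil => intro n _; simp
  | @cons g l₁ l₂ hp ih =>
    intro n hn
    rw [word_cons, word_cons, map_mul, map_mul, ← mul_sub]
    rcases n with _ | n
    · have h1 : l₁ = [] := by
        apply List.length_eq_zero_iff.mp; simp at hn; simp [hn]
      subst h1
      have h2 : l₂ = [] := by simpa using hp
      subst h2
      simp
    · exact gen_mul_filt ε g n _ (ih n (by simpa using hn))
  | swap g h l =>
    intro n hn
    have e : toW ε (word (h :: g :: l)) - toW ε (word (g :: h :: l)) =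
        (if g = h.conj then -(h.sign) * (ε : ℂ) else 0) • toW ε (word l) := by
      have := gen_comm ε h g
      simp only [gen] at this
      simp only [word_cons, map_mul]
      rw [← mul_assoc, this, add_mul, mul_assoc, add_sub_cancel_left, Algebra.smul_def]
    rw [e]
    refine Submodule.smul_mem _ _ (Submodule.subset_span ⟨l, ?_, rfl⟩)
    simp at hn; omega
  | @trans l₁ l₂ l₃ h₁ _ ih₁ ih₂ =>
    intro n hn
    have := add_mem (ih₁ n hn) (ih₂ n (h₁.length_eq ▸ hn))
    simpa using this

theorem word_mem_span (ε : ℝ) : ∀ (n : ℕ) (l : List Gen), l.length ≤ n →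
    toW ε (word l) ∈ Submodule.span ℂ (Set.range fun m => toW ε (symPoly m)) := by
  have step : ∀ (n : ℕ), (∀ l : List Gen, l.length < n →
      toW ε (word l) ∈ Submodule.span ℂ (Set.range fun m => toW ε (symPoly m))) →
      ∀ l : List Gen, l.length = n →
      toW ε (word l) ∈ Submodule.span ℂ (Set.range fun m => toW ε (symPoly m)) := by
    intro n ih l hl
    set Sp := Submodule.span ℂ (Set.range fun m => toW ε (symPoly m)) with hSp
    set F := (Multiset.lists (l : Multiset Gen)).toFinset with hF
    have hl' : l ∈ F := by rw [hF, mem_symPoly]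
    have hdiff : ∀ k ∈ F, toW ε (word k) - toW ε (word l) ∈ Sp := by
      intro k hk
      rw [hF, mem_symPoly, Multiset.coe_eq_coe] at hk
      rcases n with _ | n
      · have h1 : l = [] := List.length_eq_zero_iff.mp hl
        subst h1
        have h2 : k = [] := by simpa using hk
        subst h2
        simp
      · have h1 := perm_sub_mem ε hk n (by rw [hk.length_eq, hl])
        refine (Submodule.span_le.mpr ?_ : filt ε n ≤ Sp) h1
        rintro _ ⟨j, hj, rfl⟩
        exact ih j (by omega)
    have hsum : toW ε (symPoly l) - (F.card : ℂ) • toW ε (word l) ∈ Sp := by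
      have e : toW ε (symPoly l) - (F.card : ℂ) • toW ε (word l) =
          ∑ k ∈ F, (toW ε (word k) - toW ε (word l)) := by
        rw [Finset.sum_sub_distrib, Finset.sum_const, symPoly, map_sum, Nat.cast_smul_eq_nsmul]
      rw [e]
      exact Submodule.sum_mem _ hdiff
    have hS : toW ε (symPoly l) ∈ Sp := Submodule.subset_span ⟨_, rfl⟩
    have h3 : (F.card : ℂ) • toW ε (word l) ∈ Sp := by
      have := Submodule.sub_mem _ hS hsum
      simpa using this
    have hc : (F.card : ℂ) ≠ 0 := by
      exact_mod_cast (Finset.card_pos.mpr ⟨l, hl'⟩).ne'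
    exact (Submodule.smul_mem_iff _ hc).mp h3
  have all : ∀ (n : ℕ) (l : List Gen), l.length = n →
      toW ε (word l) ∈ Submodule.span ℂ (Set.range fun m => toW ε (symPoly m)) := by
    intro n
    induction n using Nat.strong_induction_on with
    | _ n ih => exact step n fun l hl => ih l.length hl l rfl
  intro n l _
  exact all _ l rfl

theorem span_word : Submodule.span ℂ (Set.range word) = ⊤ := by
  rw [eq_top_iff]
  rintro x -
  induction x using FreeAlgebra.induction with
  | grade0 r =>
    rw [Algebra.algebraMap_eq_smul_one]
    exact Submodule.smul_mem _ _ (Submodule.subset_span ⟨[], by simp [word]⟩)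
  | grade1 g => exact Submodule.subset_span ⟨[g], by simp [word, letter]⟩
  | mul x y hx hy =>
    have := Submodule.mul_mem_mul hx hy
    rw [Submodule.span_mul_span] at this
    refine Submodule.span_mono ?_ this
    rintro _ ⟨_, ⟨l, rfl⟩, _, ⟨k, rfl⟩, rfl⟩
    exact ⟨l ++ k, by simp [word]⟩
  | add x y hx hy => exact add_mem hx hy

theorem symPoly_span (ε : ℝ) :
    ⊤ ≤ Submodule.span ℂ (Set.range fun m => toW ε (symPoly m)) := by
  rintro x -
  obtain ⟨y, rfl⟩ := RingQuot.mkAlgHom_surjective ℂ (Rel ε) x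
  have hy : y ∈ Submodule.span ℂ (Set.range word) := by rw [span_word]; trivial
  change toW ε y ∈ _
  induction hy using Submodule.span_induction with
  | mem x h => obtain ⟨l, rfl⟩ := h; exact word_mem_span ε _ l le_rfl
  | zero => simp
  | add x y _ _ hx hy => rw [map_add]; exact add_mem hx hy
  | smul c x _ hx => rw [map_smul]; exact Submodule.smul_mem _ _ hx

/-- Auxiliary representation on commutative polynomials, used only for linear independence. -/
def actGen (ε : ℝ) (g : Gen) : Module.End ℂ (MvPolynomial Gen ℂ) :=
  LinearMap.mulLeft ℂ (MvPolynomial.X g) -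
    ((ε : ℂ) / 2 * g.sign) • (MvPolynomial.pderiv g.conj).toLinearMap

theorem actGen_comm (ε : ℝ) (g h : Gen) : actGen ε g * actGen ε h - actGen ε h * actGen ε g =
    algebraMap ℂ (Module.End ℂ (MvPolynomial Gen ℂ))
      (if h = g.conj then -(g.sign) * (ε : ℂ) else 0) := by
  have hpd : ∀ (i j : Gen) (p : MvPolynomial Gen ℂ), MvPolynomial.pderiv i (MvPolynomial.pderiv j p)
      = MvPolynomial.pderiv j (MvPolynomial.pderiv i p) := by
    intro i j p
    ext d
    simp only [MvPolynomial.coeff_pderiv]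
    by_cases hij : i = j
    · subst hij; rfl
    · simp [add_right_comm, hij, Ne.symm hij]; ring
  refine LinearMap.ext fun p => ?_
  have hX : ∀ i j : Gen, MvPolynomial.pderiv i (MvPolynomial.X j : MvPolynomial Gen ℂ) =
      if i = j then 1 else 0 := by
    intro i j
    rw [MvPolynomial.pderiv_X]
    by_cases hij : i = j
    · subst hij; simp
    · simp [hij, Ne.symm hij]
  simp only [actGen, LinearMap.sub_apply, Module.End.mul_apply, LinearMap.mulLeft_apply,
    LinearMap.smul_apply, Derivation.coeFn_coe, Derivation.leibniz, smul_eq_mul,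
    hX, Module.algebraMap_end_apply, mul_sub, mul_smul_comm, hpd g.conj h.conj]
  cases g <;> cases h <;> simp [Gen.conj, Gen.sign, MvPolynomial.smul_eq_C_mul] <;> try ring1
  all_goals
    have h2 : (MvPolynomial.C (ε : ℂ) : MvPolynomial Gen ℂ) =
        MvPolynomial.C ((ε : ℂ) / 2) + MvPolynomial.C ((ε : ℂ) / 2) := by
      rw [← map_add]; congr 1; ring
    rw [h2]
    ring

theorem act_rel (ε : ℝ) ⦃x y : FreeW⦄ (h : Rel ε x y) :
    FreeAlgebra.lift ℂ (actGen ε) x = FreeAlgebra.lift ℂ (actGen ε) y := by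
  cases h <;>
    simp [letter, FreeAlgebra.lift_ι_apply, actGen_comm, Gen.conj, Gen.sign]

def act (ε : ℝ) : W ε →ₐ[ℂ] Module.End ℂ (MvPolynomial Gen ℂ) :=
  RingQuot.liftAlgHom ℂ ⟨FreeAlgebra.lift ℂ (actGen ε), act_rel ε⟩

theorem act_gen (ε : ℝ) (g : Gen) : act ε (gen ε g) = actGen ε g := by
  have : act ε (gen ε g) = FreeAlgebra.lift ℂ (actGen ε) (letter g) :=
    RingQuot.liftAlgHom_mkAlgHom_apply ℂ _ (act_rel ε) (letter g)
  rw [this, letter, FreeAlgebra.lift_ι_apply]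

theorem act_word (ε : ℝ) (l : List Gen) : ∃ r : MvPolynomial Gen ℂ,
    (∀ d : Gen →₀ ℕ, l.length ≤ d.degree → r.coeff d = 0) ∧
    act ε (toW ε (word l)) 1 = MvPolynomial.monomial (Multiset.toFinsupp (l : Multiset Gen)) 1 + r := by
  induction l with
  | nil => exact ⟨0, by simp, by simp [word]⟩
  | cons g l ih =>
    obtain ⟨r, hr, he⟩ := ih
    set M := MvPolynomial.monomial (Multiset.toFinsupp (l : Multiset Gen)) (1 : ℂ) with hM
    refine ⟨MvPolynomial.X g * r -
      ((ε : ℂ) / 2 * g.sign) • MvPolynomial.pderiv g.conj (M + r), ?_, ?_⟩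
    · intro d hd
      have hd' : l.length + 1 ≤ d.degree := by simpa using hd
      have hdeg : (Multiset.toFinsupp (l : Multiset Gen)).degree = l.length := by
        rw [Finsupp.degree_eq_sum]
        simp only [Multiset.toFinsupp_apply, Multiset.coe_count]
        have := Multiset.sum_count_eq_card (s := Finset.univ) (m := (l : Multiset Gen)) (by simp)
        simpa using this
      have e2 : (M + r).coeff (d + Finsupp.single g.conj 1) = 0 := by
        rw [MvPolynomial.coeff_add, hr _ (by simp; omega), add_zero, hM,
          MvPolynomial.coeff_monomial, if_neg]
        intro hh
        rw [hh] at hdeg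
        simp at hdeg
        omega
      have e1 : (MvPolynomial.X g * r).coeff d = 0 := by
        rw [MvPolynomial.coeff_X_mul']
        split_ifs with hg
        · apply hr
          have h1 : d g ≠ 0 := by simpa using hg
          have h2 : d - Finsupp.single g 1 + Finsupp.single g 1 = d := by
            ext i
            by_cases hi : g = i
            · subst hi; simp; omega
            · simp [hi]
          have h3 := congrArg Finsupp.degree h2
          simp at h3
          omega
        · rfl
      rw [MvPolynomial.coeff_sub, MvPolynomial.coeff_smul, MvPolynomial.coeff_pderiv, e1, e2]
      simp
    · rw [word_cons, map_mul, map_mul, Module.End.mul_apply, he]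
      have : act ε (toW ε (letter g)) = actGen ε g := act_gen ε g
      rw [this]
      have hc : MvPolynomial.monomial (Multiset.toFinsupp ((g :: l : List Gen) : Multiset Gen)) (1 : ℂ)
          = MvPolynomial.X g * M := by
        rw [hM, MvPolynomial.X, MvPolynomial.monomial_mul, ← Multiset.cons_coe,
          ← Multiset.singleton_add, map_add, Multiset.toFinsupp_singleton]
        simp
      rw [hc]
      simp only [actGen, LinearMap.sub_apply, LinearMap.mulLeft_apply, LinearMap.smul_apply,
        Derivation.coeFn_coe, mul_add]
      ring

theorem degree_toFinsupp (m : Multiset Gen) : (Multiset.toFinsupp m).degree = m.card := by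
  rw [Finsupp.degree_eq_sum]
  simp only [Multiset.toFinsupp_apply]
  exact Multiset.sum_count_eq_card (s := Finset.univ) (m := m) (by simp)

theorem coeff_symPoly (ε : ℝ) (m k : Multiset Gen) (h : m.card ≤ k.card) :
    (act ε (toW ε (symPoly m)) 1).coeff (Multiset.toFinsupp k) =
      if m = k then (m.lists.toFinset.card : ℂ) else 0 := by
  have key : ∀ l ∈ m.lists.toFinset,
      (act ε (toW ε (word l)) 1).coeff (Multiset.toFinsupp k) = if m = k then 1 else 0 := by
    intro l hl
    rw [mem_symPoly] at hl
    obtain ⟨r, hr, he⟩ := act_word ε l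
    rw [he, MvPolynomial.coeff_add, hr _ (by rw [degree_toFinsupp]; simpa [← hl] using h), hl,
      MvPolynomial.coeff_monomial, add_zero]
    simp
  rw [symPoly, map_sum, map_sum, LinearMap.sum_apply, MvPolynomial.coeff_sum, Finset.sum_congr rfl key]
  split_ifs <;> simp

theorem symPoly_linearIndependent (ε : ℝ) :
    LinearIndependent ℂ fun m => toW ε (symPoly m) := by
  rw [linearIndependent_iff]
  intro v hv
  by_contra hne
  obtain ⟨k, hk, hmax⟩ := v.support.exists_max_image Multiset.card
    (Finsupp.support_nonempty_iff.mpr hne)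
  have h1 := congrArg (fun x => (act ε x 1).coeff (Multiset.toFinsupp k)) hv
  simp only [Finsupp.linearCombination_apply, Finsupp.sum, map_sum, map_smul, LinearMap.sum_apply,
    LinearMap.smul_apply, MvPolynomial.coeff_sum, MvPolynomial.coeff_smul, map_zero,
    LinearMap.zero_apply, MvPolynomial.coeff_zero] at h1
  rw [Finset.sum_congr rfl fun m hm => by rw [coeff_symPoly ε m k (hmax m hm)]] at h1
  simp only [smul_eq_mul, mul_ite, mul_zero, Finset.sum_ite_eq', hk, if_true] at h1
  rcases mul_eq_zero.mp h1 with h | h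
  · exact (Finsupp.mem_support_iff.mp hk) h
  · rw [Nat.cast_eq_zero, Finset.card_eq_zero] at h
    have : k.toList ∈ k.lists.toFinset := by rw [mem_symPoly]; simp
    rw [h] at this
    simp at this

/-- The basis `S(s,t,u,v)` of `𝒲(ε)`. Through it, all the `𝒲(ε)` are identified with one and the
same vector space, that of totally symmetric polynomials. -/
def symBasis (ε : ℝ) : Module.Basis (Multiset Gen) ℂ (W ε) :=
  Module.Basis.mk (symPoly_linearIndependent ε) (symPoly_span ε)

theorem symBasis_apply (ε : ℝ) (m : Multiset Gen) : symBasis ε m = toW ε (symPoly m) := by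
  simp [symBasis]

/-! ## The elements `J`, `K` -/

def J0 (ε : ℝ) : W ε :=
  (1 / 2 : ℂ) • (gen ε .ap * gen ε .am - gen ε .bp * gen ε .bm)

def Jp (ε : ℝ) : W ε := gen ε .ap * gen ε .bm

def Jm (ε : ℝ) : W ε := gen ε .am * gen ε .bp

def K0 (ε : ℝ) : W ε :=
  (1 / 2 : ℂ) • (gen ε .ap * gen ε .am + gen ε .bp * gen ε .bm + algebraMap ℂ (W ε) (ε : ℂ))

/-! ## Conjugation -/

/-- Complex conjugation of the coefficients of a noncommutative polynomial. -/
def conjCoeff : FreeW →+* FreeW :=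
  (FreeAlgebra.equivMonoidAlgebraFreeMonoid (R := ℂ) (X := Gen)).symm.toRingEquiv.toRingHom.comp
    ((MonoidAlgebra.mapRingHom (FreeMonoid Gen) (starRingEnd ℂ)).comp
      (FreeAlgebra.equivMonoidAlgebraFreeMonoid (R := ℂ) (X := Gen)).toRingEquiv.toRingHom)

theorem conjCoeff_letter (g : Gen) : conjCoeff (letter g) = letter g := by
  simp [conjCoeff, letter, FreeAlgebra.equivMonoidAlgebraFreeMonoid]

theorem conjCoeff_scalar (c : ℂ) :
    conjCoeff (algebraMap ℂ FreeW c) = algebraMap ℂ FreeW (starRingEnd ℂ c) := by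
  simp [conjCoeff, FreeAlgebra.equivMonoidAlgebraFreeMonoid, Algebra.algebraMap_eq_smul_one,
    MonoidAlgebra.one_def]

/-- The conjugation, as a ring homomorphism from the free algebra to the opposite of `𝒲(ε)`. -/
def preDagger (ε : ℝ) : FreeW →+* (W ε)ᵐᵒᵖ :=
  (FreeAlgebra.lift ℂ fun g : Gen => MulOpposite.op (gen ε g.conj)).toRingHom.comp conjCoeff

theorem preDagger_letter (ε : ℝ) (g : Gen) :
    preDagger ε (letter g) = MulOpposite.op (gen ε g.conj) := by
  simp only [preDagger, RingHom.comp_apply, conjCoeff_letter]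
  simp [letter]

theorem preDagger_scalar (ε : ℝ) (c : ℂ) :
    preDagger ε (algebraMap ℂ FreeW c) = MulOpposite.op (algebraMap ℂ (W ε) (starRingEnd ℂ c)) := by
  simp only [preDagger, RingHom.comp_apply, conjCoeff_scalar]
  simp

theorem preDagger_rel (ε : ℝ) ⦃x y : FreeW⦄ (h : Rel ε x y) : preDagger ε x = preDagger ε y := by
  cases h <;>
    simp only [map_sub, map_mul, preDagger_letter, preDagger_scalar, map_zero, ← MulOpposite.op_mul,
      ← MulOpposite.op_sub] <;>
    first
    | rw [gen_comm]; simp [Gen.conj, Gen.sign]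

/-- The conjugation, as a ring homomorphism from `𝒲(ε)` to its opposite. -/
def daggerHom (ε : ℝ) : W ε →+* (W ε)ᵐᵒᵖ := RingQuot.lift ⟨preDagger ε, preDagger_rel ε⟩

theorem daggerHom_toW (ε : ℝ) (x : FreeW) : daggerHom ε (toW ε x) = preDagger ε x := by
  have h : toW ε x = RingQuot.mkRingHom (Rel ε) x :=
    RingHom.congr_fun (RingQuot.mkAlgHom_coe ℂ (Rel ε)) x
  rw [h]
  exact RingQuot.lift_mkRingHom_apply (preDagger ε) (preDagger_rel ε) x

/-- The conjugation `†` of `𝒲(ε)`, conjugate linear. -/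
def dagger (ε : ℝ) : W ε →ₗ⋆[ℂ] W ε where
  toFun w := (daggerHom ε w).unop
  map_add' x y := by simp
  map_smul' c x := by
    have h : daggerHom ε (algebraMap ℂ (W ε) c) =
        MulOpposite.op (algebraMap ℂ (W ε) (starRingEnd ℂ c)) := by
      rw [← preDagger_scalar, ← daggerHom_toW, AlgHom.commutes]
    rw [Algebra.smul_def, map_mul, h, Algebra.smul_def, MulOpposite.unop_mul,
      MulOpposite.unop_op, Algebra.commutes]

theorem dagger_mul (ε : ℝ) (x y : W ε) : dagger ε (x * y) = dagger ε y * dagger ε x := by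
  simp [dagger]

theorem dagger_gen (ε : ℝ) (g : Gen) : dagger ε (gen ε g) = gen ε g.conj := by
  have : dagger ε (gen ε g) = (daggerHom ε (toW ε (letter g))).unop := rfl
  rw [this, daggerHom_toW, preDagger_letter, MulOpposite.unop_op]

theorem dagger_scalar (ε : ℝ) (c : ℂ) :
    dagger ε (algebraMap ℂ (W ε) c) = algebraMap ℂ (W ε) (starRingEnd ℂ c) := by
  have : dagger ε (algebraMap ℂ (W ε) c) = (daggerHom ε (algebraMap ℂ (W ε) c)).unop := rfl
  rw [this, ← AlgHom.commutes (toW ε), daggerHom_toW, preDagger_scalar, MulOpposite.unop_op]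

/-! ## Formal trace and the space `Ψ` -/

/-- On a word: delete the last two letters if they are `a₊a₋`, `a₋a₊`, `b₊b₋` or `b₋b₊`;
all other words (in particular those with fewer than two letters) go to zero. -/
def contractWord (l : List Gen) : FreeW :=
  match l.reverse with
  | y :: x :: k => if y = x.conj then word k.reverse else 0
  | _ => 0

/-- Linear extension of `contractWord` to noncommutative polynomials. -/
def contract : FreeW →ₗ[ℂ] FreeW :=
  (FreeAlgebra.basisFreeMonoid ℂ Gen).constr ℂ fun l => contractWord l.toList

theorem contract_word (l : List Gen) : contract (word l) = contractWord l := by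
  have h : word l = FreeAlgebra.basisFreeMonoid ℂ Gen (FreeMonoid.ofList l) := by
    simp [FreeAlgebra.basisFreeMonoid, FreeAlgebra.equivMonoidAlgebraFreeMonoid, word,
      FreeMonoid.lift_apply]
    rfl
  rw [h, contract, Module.Basis.constr_basis]
  rfl

/-- The unique totally symmetric polynomial which represents a given element of `𝒲(ε)`. -/
def symRep (ε : ℝ) : W ε →ₗ[ℂ] FreeW := (symBasis ε).constr ℂ symPoly

/-- The formal trace: write `w` as a totally symmetric polynomial, and contract the last two
letters of each of its words. -/
def tr (ε : ℝ) : W ε →ₗ[ℂ] W ε := (toW ε).toLinearMap ∘ₗ contract ∘ₗ symRep ε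

/-- The space `Ψ` of formally traceless symmetric polynomials. -/
def Psi (ε : ℝ) : Submodule ℂ (W ε) := LinearMap.ker (tr ε)

/-! ## The grading by `Ad K₀` -/

/-- The operator `ε⁻¹ Ad K₀`, continued to `ε = 0`: it multiplies a symmetric polynomial by
half the number of letters `a₊, b₊` minus half the number of letters `a₋, b₋`.
See `smul_adK0` for the relation with the commutator. -/
def adK0 (ε : ℝ) : W ε →ₗ[ℂ] W ε :=
  (symBasis ε).constr ℂ fun m => ((m.map Gen.sign).sum / 2) • symBasis ε m

theorem K0_gen (ε : ℝ) (g : Gen) :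
    K0 ε * gen ε g - gen ε g * K0 ε = ((ε : ℂ) * (g.sign / 2)) • gen ε g := by
  have hc : ∀ x : W ε, algebraMap ℂ (W ε) (ε : ℂ) * x - x * algebraMap ℂ (W ε) (ε : ℂ) = 0 := by
    intro x; rw [Algebra.commutes, sub_self]
  have h3 : ∀ x y z : W ε, x * y * z - z * (x * y) = x * (y * z - z * y) + (x * z - z * x) * y := by
    intro x y z; noncomm_ring
  have hg : ∀ g h : Gen, gen ε g * gen ε h - gen ε h * gen ε g =
      algebraMap ℂ (W ε) (if h = g.conj then -(g.sign) * (ε : ℂ) else 0) := by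
    intro g h; rw [gen_comm]; abel
  have e : K0 ε * gen ε g - gen ε g * K0 ε = (1 / 2 : ℂ) •
      ((gen ε .ap * gen ε .am * gen ε g - gen ε g * (gen ε .ap * gen ε .am)) +
      (gen ε .bp * gen ε .bm * gen ε g - gen ε g * (gen ε .bp * gen ε .bm)) +
      (algebraMap ℂ (W ε) (ε : ℂ) * gen ε g - gen ε g * algebraMap ℂ (W ε) (ε : ℂ))) := by
    rw [K0, smul_mul_assoc, mul_smul_comm, ← smul_sub]
    congr 1
    noncomm_ring
  rw [e, hc, h3, h3, hg, hg, hg, hg, add_zero]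
  cases g <;> simp [Gen.conj, Gen.sign, Algebra.algebraMap_eq_smul_one] <;> ring_nf <;> module

theorem K0_word (ε : ℝ) (l : List Gen) :
    K0 ε * toW ε (word l) - toW ε (word l) * K0 ε =
      ((ε : ℂ) * ((l.map Gen.sign).sum / 2)) • toW ε (word l) := by
  induction l with
  | nil => simp [word]
  | cons g l ih =>
    rw [word_cons, map_mul]
    have h : K0 ε * (toW ε (letter g) * toW ε (word l)) -
        toW ε (letter g) * toW ε (word l) * K0 ε =
        (K0 ε * toW ε (letter g) - toW ε (letter g) * K0 ε) * toW ε (word l) +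
        toW ε (letter g) * (K0 ε * toW ε (word l) - toW ε (word l) * K0 ε) := by
      noncomm_ring
    have hg : K0 ε * toW ε (letter g) - toW ε (letter g) * K0 ε =
      ((ε : ℂ) * (g.sign / 2)) • toW ε (letter g) := K0_gen ε g
    rw [h, ih, hg, smul_mul_assoc, mul_smul_comm, ← add_smul]
    congr 1
    simp
    ring

/-- `ε · adK0 = Ad K₀`. -/
theorem smul_adK0 (ε : ℝ) (w : W ε) : (ε : ℂ) • adK0 ε w = K0 ε * w - w * K0 ε := by
  have h : (ε : ℂ) • adK0 ε = LinearMap.mulLeft ℂ (K0 ε) - LinearMap.mulRight ℂ (K0 ε) := by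
    refine (symBasis ε).ext fun m => ?_
    simp only [LinearMap.smul_apply, LinearMap.sub_apply, LinearMap.mulLeft_apply,
      LinearMap.mulRight_apply, adK0, Module.Basis.constr_basis]
    rw [symBasis_apply, symPoly, map_sum, Finset.mul_sum, Finset.sum_mul, ← Finset.sum_sub_distrib,
      smul_smul, Finset.smul_sum]
    refine Finset.sum_congr rfl fun l hl => ?_
    rw [mem_symPoly] at hl
    rw [K0_word, ← hl]
    simp
  exact LinearMap.congr_fun h w

/-- The subspace `Ψ_r = {ξ ∈ Ψ | ε⁻¹ Ad K₀ ξ = r ξ}` (continued to `ε = 0`). -/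
def PsiR (ε : ℝ) (r : ℝ) : Submodule ℂ (W ε) :=
  Psi ε ⊓ LinearMap.ker (adK0 ε - (r : ℂ) • LinearMap.id)

/-- For `ε ≠ 0`, `Ψ_r` is the eigenspace of `Ad K₀` in `Ψ` to the eigenvalue `ε r`. -/
theorem mem_PsiR_iff {ε : ℝ} (hε : ε ≠ 0) (r : ℝ) (ξ : W ε) :
    ξ ∈ PsiR ε r ↔ ξ ∈ Psi ε ∧ K0 ε * ξ - ξ * K0 ε = ((ε : ℂ) * r) • ξ := by
  have h0 : (ε : ℂ) ≠ 0 := by exact_mod_cast hε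
  rw [PsiR, Submodule.mem_inf, LinearMap.mem_ker, LinearMap.sub_apply, sub_eq_zero,
    ← smul_adK0, mul_smul, smul_right_inj h0]
  rfl

/-! ## The projections, the products and the sesquilinear form -/

/-- `R̂ = √(R² + ε²/4)`. -/
def Rhat (ε R : ℝ) : ℝ := Real.sqrt (R ^ 2 + ε ^ 2 / 4)

/-- `{w (K₀ - R̂) | w ∈ 𝒲}`. -/
def kerRho (ε R : ℝ) : Submodule ℂ (W ε) :=
  LinearMap.range (LinearMap.mulRight ℂ (K0 ε - algebraMap ℂ (W ε) (Rhat ε R : ℂ)))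

/-- `{(K₀ - R̂) w | w ∈ 𝒲}`. -/
def kerRhoStar (ε R : ℝ) : Submodule ℂ (W ε) :=
  LinearMap.range (LinearMap.mulLeft ℂ (K0 ε - algebraMap ℂ (W ε) (Rhat ε R : ℂ)))

open scoped Classical in
/-- The projection `ρ` of `𝒲` onto `Ψ` with kernel `{w (K₀ - R̂)}`. The two subspaces are
complementary, so that the second branch is never taken. -/
def rho (ε R : ℝ) : W ε →ₗ[ℂ] W ε :=
  if h : IsCompl (Psi ε) (kerRho ε R) then (Psi ε).projection (kerRho ε R) h else 0

open scoped Classical in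
/-- The projection `ρ⋆` of `𝒲` onto `Ψ` with kernel `{(K₀ - R̂) w}`. The two subspaces are
complementary, so that the second branch is never taken. -/
def rhoStar (ε R : ℝ) : W ε →ₗ[ℂ] W ε :=
  if h : IsCompl (Psi ε) (kerRhoStar ε R) then (Psi ε).projection (kerRhoStar ε R) h else 0

/-- The projection `π₀` onto the constants: the coefficient of `S(0,0,0,0) = 1`. -/
def pi0 (ε : ℝ) : W ε →ₗ[ℂ] ℂ := (symBasis ε).coord 0

/-- The sesquilinear form `⟨ξ,ζ⟩ = π₀(ρ(ξ† ζ))` on `Ψ`. -/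
def sesqForm (ε R : ℝ) : Psi ε →ₗ⋆[ℂ] Psi ε →ₗ[ℂ] ℂ :=
  LinearMap.mk₂'ₛₗ (starRingEnd ℂ) (RingHom.id ℂ)
    (fun ξ ζ => pi0 ε (rho ε R (dagger ε (ξ : W ε) * (ζ : W ε))))
    (fun x y z => by simp [add_mul])
    (fun c x y => by simp)
    (fun x y z => by simp [mul_add])
    (fun c x y => by simp)

/-! ## The fuzzy sphere algebra `𝒫(ε,R)` -/

/-- The letters `J₊, J₋, J₀`. -/
inductive SGen where
  | p | m | z

/-- `[J₀,J₊] = ε J₊`, `[J₀,J₋] = -ε J₋`, `[J₊,J₋] = 2ε J₀`,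
`J₀² + ½ J₊J₋ + ½ J₋J₊ = R²`. -/
inductive SRel (ε R : ℝ) : FreeAlgebra ℂ SGen → FreeAlgebra ℂ SGen → Prop
  | zp : SRel ε R (.ι ℂ .z * .ι ℂ .p - .ι ℂ .p * .ι ℂ .z) ((ε : ℂ) • .ι ℂ .p)
  | zm : SRel ε R (.ι ℂ .z * .ι ℂ .m - .ι ℂ .m * .ι ℂ .z) (-(ε : ℂ) • .ι ℂ .m)
  | pm : SRel ε R (.ι ℂ .p * .ι ℂ .m - .ι ℂ .m * .ι ℂ .p) ((2 * ε : ℂ) • .ι ℂ .z)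
  | cas : SRel ε R
      (.ι ℂ .z ^ 2 + (1 / 2 : ℂ) • (.ι ℂ .p * .ι ℂ .m) + (1 / 2 : ℂ) • (.ι ℂ .m * .ι ℂ .p))
      (algebraMap ℂ _ ((R : ℂ) ^ 2))

/-- The algebra `𝒫(ε,R)`. -/
def P (ε R : ℝ) : Type := RingQuot (SRel ε R)

instance (ε R : ℝ) : Ring (P ε R) := inferInstanceAs (Ring (RingQuot (SRel ε R)))

instance (ε R : ℝ) : Algebra ℂ (P ε R) := inferInstanceAs (Algebra ℂ (RingQuot (SRel ε R)))

/-- The generators of `𝒫(ε,R)`. -/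
def pGen (ε R : ℝ) (g : SGen) : P ε R := RingQuot.mkAlgHom ℂ (SRel ε R) (FreeAlgebra.ι ℂ g)

/-! ## Dependence on `ε` -/

/-- The element of `𝒲(ε)` given by an `ε`-independent combination of the basis `S(s,t,u,v)`. -/
def elt (ε : ℝ) (v : Multiset Gen →₀ ℂ) : W ε := (symBasis ε).repr.symm v

/-- The `ℓ¹` norm of the coordinates with respect to the basis `S(s,t,u,v)`. -/
def coordNorm (ε : ℝ) (w : W ε) : ℝ := ((symBasis ε).repr w).sum fun _ c => ‖c‖

end FuzzySphere

end

open FuzzySphere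

/-! The proof transports everything to commutative polynomials in four variables through the Weyl
symbol. The operators X_g ∓ (ε/2) sign(g) ∂_{ḡ} (ḡ the conjugate letter) represent left and right
multiplication by a letter g, and applying w to the vector 1 sends S(m) to a multinomial coefficient
times the monomial of m (`act_symBasis`), with no ε-correction. Up to the injective factor
(E+1)(E+2)/2, E the Euler operator, the formal trace becomes the Laplacian (`eulerSq_symbol_tr`), so
Ψ is the space of harmonic polynomials. Multiplication by 2(K₀ - R̂) becomes multiplication by the
quadratic form q = a₊a₋ + b₊b₋ plus an operator which commutes with the Laplacian and does not raise
degree.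

A perturbed Fischer decomposition (`fischer_injective`, `isCompl_harmonic`) then shows that both
projections exist. The kernel of ρ is a left ideal, whence ρ(w₁ρ(w₂)) = ρ(w₁w₂). Elements of weight
zero for Ad K₀ commute with K₀ - R̂, so right multiplication by them also preserves the kernel
(`rho_rho_mul`), and on weight zero ρ and ρ⋆ agree (`rhoStar_eq_rho`). This gives the algebra Ψ₀ and
the module statements. Since † exchanges ρ and ρ⋆, and the constant term only sees weight zero, the
form is Hermitian.

For the isomorphism, the Casimir element equals K₀² - ε²/4, which is R² modulo K₀ - R̂
(`casimir_eq`), so 𝒫 acts on Ψ₀ by f ↦ ρ(Jf); evaluation at 1 is the map. It is onto because a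
weight-zero monomial can be built, up to lower degree, from pairs a₊a₋, a₊b₋, b₊a₋, b₊b₋, which are
combinations of the J's, K₀ and 1 (`rho_symm_mem`). It is one-to-one because 𝒫 is spanned by J₀ʲJ₊ⁱ
and J₀ʲJ₋ⁱ⁺¹, whose leading symbols restrict to distinct monomials on the cone q = 0
(`eq_zero_of_rho_sum_normalWord`).

For ε → 0, products and projections of fixed polynomials are finite sums of fixed polynomials with
coefficients c(0) + O(ε). The difference of the two bracketings is such a family, and it vanishes at
ε = 0, where the algebra is commutative. -/

noncomputable section
namespace FuzzySphere
open MvPolynomial (X pderiv monomial coeff)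

/-! ## Differential operators on commutative polynomials -/

/-- Commutative polynomials in the four letters, the space of Weyl symbols. -/
abbrev Poly : Type := MvPolynomial Gen ℂ

theorem pderiv_comm_apply (i j : Gen) (p : Poly) :
    pderiv i (pderiv j p) = pderiv j (pderiv i p) := by
  ext d
  simp only [MvPolynomial.coeff_pderiv]
  by_cases hij : i = j
  · subst hij; rfl
  · simp [add_right_comm, hij, Ne.symm hij]; ring

theorem pderiv_X_apply (i j : Gen) : pderiv i (X j : Poly) = if i = j then 1 else 0 := by
  rw [MvPolynomial.pderiv_X]
  by_cases hij : i = j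
  · subst hij; simp
  · simp [hij, Ne.symm hij]

/-- The quadratic form `a₊a₋ + b₊b₋`. -/
def quad : Poly := X .ap * X .am + X .bp * X .bm

/-- The Laplacian `∂_{a₊}∂_{a₋} + ∂_{b₊}∂_{b₋}`. -/
def lap : Poly →ₗ[ℂ] Poly :=
  (pderiv .ap).toLinearMap ∘ₗ (pderiv .am).toLinearMap +
    (pderiv .bp).toLinearMap ∘ₗ (pderiv .bm).toLinearMap

theorem lap_apply (f : Poly) :
    lap f = pderiv .ap (pderiv .am f) + pderiv .bp (pderiv .bm f) := rfl

/-- The diagonal operator `∑ c_g X_g ∂_g`. -/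
def diagOp (c : Gen → ℂ) : Poly →ₗ[ℂ] Poly :=
  ∑ g, c g • (LinearMap.mulLeft ℂ (X g) ∘ₗ (pderiv g).toLinearMap)

theorem sum_gen {M : Type*} [AddCommMonoid M] (f : Gen → M) :
    ∑ g, f g = f .am + f .ap + f .bm + f .bp := by
  have : (Finset.univ : Finset Gen) = {.am, .ap, .bm, .bp} := rfl
  rw [this]
  simp [add_assoc]

theorem diagOp_apply (c : Gen → ℂ) (f : Poly) :
    diagOp c f = c .am • (X .am * pderiv .am f) + c .ap • (X .ap * pderiv .ap f) +
      c .bm • (X .bm * pderiv .bm f) + c .bp • (X .bp * pderiv .bp f) := by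
  simp [diagOp, sum_gen]

/-- The Euler operator. -/
def euler : Poly →ₗ[ℂ] Poly := diagOp fun _ => 1

/-- The signed Euler operator, which counts letters `a₊, b₊` minus letters `a₋, b₋`. -/
def wtOp : Poly →ₗ[ℂ] Poly := diagOp Gen.sign

theorem coeff_diagOp (c : Gen → ℂ) (f : Poly) (d : Gen →₀ ℕ) :
    coeff d (diagOp c f) = (∑ g, c g * d g) * coeff d f := by
  have h : ∀ g : Gen, coeff d (X g * pderiv g f) = d g * coeff d f := by
    intro g
    rw [MvPolynomial.coeff_X_mul']
    split_ifs with hg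
    · have h1 : d g ≠ 0 := by simpa using hg
      have h2 : d - Finsupp.single g 1 + Finsupp.single g 1 = d := by
        ext i
        by_cases hi : g = i
        · subst hi; simp; omega
        · simp [hi]
      rw [MvPolynomial.coeff_pderiv, h2]
      have h3 : (((d - Finsupp.single g 1 : Gen →₀ ℕ) g : ℕ) : ℂ) + 1 = d g := by
        have : (d - Finsupp.single g 1 : Gen →₀ ℕ) g + 1 = d g := by simp; omega
        exact_mod_cast this
      rw [h3, mul_comm]
    · have h1 : d g = 0 := by simpa using hg
      simp [h1]
  rw [diagOp]
  simp only [LinearMap.sum_apply, LinearMap.smul_apply, LinearMap.comp_apply,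
    LinearMap.mulLeft_apply, Derivation.coeFn_coe, MvPolynomial.coeff_sum, MvPolynomial.coeff_smul,
    h, Finset.sum_mul, smul_eq_mul, mul_assoc]

theorem coeff_euler (f : Poly) (d : Gen →₀ ℕ) :
    coeff d (euler f) = (d.degree : ℂ) * coeff d f := by
  rw [euler, coeff_diagOp, Finsupp.degree_eq_sum]
  simp

/-- The number of letters `a₊, b₊` minus the number of letters `a₋, b₋`. -/
def wt (d : Gen →₀ ℕ) : ℂ := ∑ g, g.sign * d g

theorem coeff_wtOp (f : Poly) (d : Gen →₀ ℕ) : coeff d (wtOp f) = wt d * coeff d f :=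
  coeff_diagOp _ _ _

/-- The sl₂ commutation relation behind the Fischer decomposition; the constant 2 is one for each
conjugate pair of variables. -/
theorem lap_quad (f : Poly) : lap (quad * f) = quad * lap f + euler f + (2 : ℂ) • f := by
  simp only [lap_apply, quad, euler, diagOp_apply, Derivation.leibniz, map_add, smul_eq_mul,
    pderiv_X_apply, map_zero,
    if_true, if_false, reduceCtorEq, Derivation.map_one_eq_zero, one_smul, two_smul]
  ring

/-- Each term of the Laplacian removes one conjugate pair and so shifts the eigenvalue of the
diagonal operator by the sum of the two weights, which must agree for both pairs. The sum is 2 for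
the Euler operator and 0 for the signed one. -/
theorem lap_diagOp (c : Gen → ℂ) (s : ℂ) (ha : c .am + c .ap = s) (hb : c .bm + c .bp = s)
    (f : Poly) : lap (diagOp c f) = diagOp c (lap f) + s • lap f := by
  have h1 : c .ap = s - c .am := by rw [← ha]; ring
  have h2 : c .bp = s - c .bm := by rw [← hb]; ring
  simp only [lap_apply, diagOp_apply, Derivation.leibniz, map_add, smul_eq_mul,
    pderiv_X_apply, MvPolynomial.pderiv_C, map_zero, if_true, if_false, reduceCtorEq, Derivation.map_one_eq_zero, h1, h2,
    pderiv_comm_apply .am .ap, pderiv_comm_apply .bm .bp, pderiv_comm_apply .bm .ap,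
    pderiv_comm_apply .bp .ap, pderiv_comm_apply .bm .am, pderiv_comm_apply .bp .am,
    MvPolynomial.smul_eq_C_mul, map_sub]
  ring

theorem lap_euler (f : Poly) : lap (euler f) = euler (lap f) + (2 : ℂ) • lap f :=
  lap_diagOp _ 2 (by norm_num) (by norm_num) f

theorem lap_wtOp (f : Poly) : lap (wtOp f) = wtOp (lap f) := by
  rw [wtOp, lap_diagOp _ 0 (by simp [Gen.sign]) (by simp [Gen.sign]), zero_smul, add_zero]

theorem wtOp_mul (f g : Poly) : wtOp (f * g) = wtOp f * g + f * wtOp g := by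
  simp only [wtOp, diagOp_apply, Derivation.leibniz, smul_eq_mul, MvPolynomial.smul_eq_C_mul]
  ring

/-! ## The filtration by degree -/

/-- Polynomials of degree less than `n`. -/
def degLT (n : ℕ) : Submodule ℂ Poly where
  carrier := {f | ∀ d : Gen →₀ ℕ, n ≤ d.degree → coeff d f = 0}
  add_mem' hf hg d hd := by rw [MvPolynomial.coeff_add, hf d hd, hg d hd, add_zero]
  zero_mem' d _ := by simp
  smul_mem' c f hf d hd := by rw [MvPolynomial.coeff_smul, hf d hd, smul_zero]

theorem mem_degLT {n : ℕ} {f : Poly} :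
    f ∈ degLT n ↔ ∀ d : Gen →₀ ℕ, n ≤ d.degree → coeff d f = 0 := Iff.rfl

theorem degLT_mono {m n : ℕ} (h : m ≤ n) : degLT m ≤ degLT n :=
  fun _ hf d hd => hf d (h.trans hd)

theorem eq_zero_of_mem_degLT_zero {f : Poly} (hf : f ∈ degLT 0) : f = 0 := by
  ext d; simpa using hf d (Nat.zero_le _)

theorem monomial_mem_degLT {n : ℕ} {d : Gen →₀ ℕ} (h : d.degree < n) (c : ℂ) :
    monomial d c ∈ degLT n := by
  intro e he
  rw [MvPolynomial.coeff_monomial, if_neg]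
  rintro rfl
  omega

theorem degLT_eq_span (n : ℕ) : degLT n =
    Submodule.span ℂ ((fun d => monomial d (1 : ℂ)) '' {d : Gen →₀ ℕ | d.degree < n}) := by
  apply le_antisymm
  · intro f hf
    rw [f.as_sum]
    refine Submodule.sum_mem _ fun d hd => ?_
    have hd' : d.degree < n := by
      by_contra h
      exact (MvPolynomial.mem_support_iff.mp hd) (hf d (not_lt.mp h))
    have : monomial d (coeff d f) = coeff d f • monomial d (1 : ℂ) := by
      rw [MvPolynomial.smul_monomial, smul_eq_mul, mul_one]
    rw [this]
    exact Submodule.smul_mem _ _ (Submodule.subset_span ⟨d, hd', rfl⟩)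
  · rw [Submodule.span_le]
    rintro _ ⟨d, hd, rfl⟩
    exact monomial_mem_degLT hd 1

instance (n : ℕ) : FiniteDimensional ℂ (degLT n) := by
  rw [degLT_eq_span]
  refine FiniteDimensional.span_of_finite ℂ (Set.Finite.image _ ?_)
  exact (Finsupp.finite_of_degree_le (σ := Gen) n).subset fun d hd => (le_of_lt hd : _ ≤ n)

theorem exists_mem_degLT (f : Poly) : ∃ n, f ∈ degLT n := by
  refine ⟨f.support.sup Finsupp.degree + 1, fun d hd => ?_⟩
  by_contra h
  have := Finset.le_sup (f := Finsupp.degree) (MvPolynomial.mem_support_iff.mpr h)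
  omega

theorem X_mul_mem_degLT (g : Gen) {n : ℕ} {f : Poly} (hf : f ∈ degLT n) :
    X g * f ∈ degLT (n + 1) := by
  intro d hd
  rw [MvPolynomial.coeff_X_mul']
  split_ifs with hg
  · apply hf
    have h1 : d g ≠ 0 := by simpa using hg
    have h2 : d - Finsupp.single g 1 + Finsupp.single g 1 = d := by
      ext i
      by_cases hi : g = i
      · subst hi; simp; omega
      · simp [hi]
    have h3 := congrArg Finsupp.degree h2
    simp at h3
    omega
  · rfl

theorem pderiv_mem_degLT (g : Gen) {n : ℕ} {f : Poly} (hf : f ∈ degLT n) :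
    pderiv g f ∈ degLT (n - 1) := by
  intro d hd
  rw [MvPolynomial.coeff_pderiv, hf _ (by simp; omega), zero_mul]

theorem quad_mul_mem_degLT {n : ℕ} {f : Poly} (hf : f ∈ degLT n) : quad * f ∈ degLT (n + 2) := by
  rw [quad, add_mul, mul_assoc, mul_assoc]
  exact add_mem (X_mul_mem_degLT _ (X_mul_mem_degLT _ hf))
    (X_mul_mem_degLT _ (X_mul_mem_degLT _ hf))

/-- Truncated subtraction costs nothing: `degLT 0` is zero, and the Laplacian kills degree at most
1. -/
theorem lap_mem_degLT {n : ℕ} {f : Poly} (hf : f ∈ degLT n) : lap f ∈ degLT (n - 2) :=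
  add_mem (pderiv_mem_degLT _ (pderiv_mem_degLT _ hf))
    (pderiv_mem_degLT _ (pderiv_mem_degLT _ hf))

theorem diagOp_mem_degLT (c : Gen → ℂ) {n : ℕ} {f : Poly} (hf : f ∈ degLT n) :
    diagOp c f ∈ degLT n := by
  intro d hd
  rw [coeff_diagOp, hf d hd, mul_zero]

/-! ## Fischer decomposition -/

/-- The family of equations in (k, c) is closed under the Laplacian, which lowers the degree; this
is why the induction needs general k and c, although only k = 1, c = 2 is used. -/
theorem fischer_injective (L : Poly →ₗ[ℂ] Poly) (hL : ∀ f, lap (L f) = L (lap f)) :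
    ∀ (n k c : ℕ), 0 < c → ∀ f ∈ degLT n,
      quad * lap f + (k : ℂ) • euler f + (c : ℂ) • f + L (lap f) = 0 → f = 0 := by
  intro n
  induction n using Nat.strong_induction_on with
  | _ n ih =>
    intro k c hc f hf h
    rcases Nat.eq_zero_or_pos n with rfl | hn
    · exact eq_zero_of_mem_degLT_zero hf
    -- By the commutation relations this is the same equation for the Laplacian of f, with k + 1 and
    -- 2 + 2k + c in place of k and c.
    have h2 := congrArg lap h
    simp only [map_add, map_smul, lap_quad, lap_euler, hL, map_zero] at h2
    have h3 : lap f = 0 := by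
      rcases Nat.lt_or_ge (n - 2) n with hlt | hge
      · refine ih (n - 2) hlt (k + 1) (2 + 2 * k + c) (by omega) _ (lap_mem_degLT hf) ?_
        rw [← h2]
        push_cast
        module
      · omega
    rw [h3] at h
    simp only [mul_zero, map_zero, zero_add, add_zero] at h
    -- Only k E + c is left, and its eigenvalue k·deg + c is positive.
    ext d
    have h4 := congrArg (coeff d) h
    rw [MvPolynomial.coeff_add, MvPolynomial.coeff_smul, MvPolynomial.coeff_smul, coeff_euler,
      smul_eq_mul, smul_eq_mul, MvPolynomial.coeff_zero, ← mul_assoc, ← add_mul] at h4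
    rw [MvPolynomial.coeff_zero]
    refine (mul_eq_zero.mp h4).resolve_left ?_
    have : k * d.degree + c ≠ 0 := by omega
    exact_mod_cast this

/-- Multiplication by the quadratic form, perturbed by an operator of lower degree. -/
def perturbedQuad (L : Poly →ₗ[ℂ] Poly) : Poly →ₗ[ℂ] Poly := LinearMap.mulLeft ℂ quad + L

theorem perturbedQuad_apply (L : Poly →ₗ[ℂ] Poly) (f : Poly) :
    perturbedQuad L f = quad * f + L f := rfl

/-- An operator which commutes with the Laplacian and does not raise the degree. -/
structure Admissible (L : Poly →ₗ[ℂ] Poly) : Prop where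
  lap_comm : ∀ f, lap (L f) = L (lap f)
  mem_degLT : ∀ n, ∀ f ∈ degLT n, L f ∈ degLT n

theorem lap_perturbedQuad {L : Poly →ₗ[ℂ] Poly} (hL : Admissible L) (f : Poly) :
    lap (perturbedQuad L f) =
      quad * lap f + ((1 : ℕ) : ℂ) • euler f + ((2 : ℕ) : ℂ) • f + L (lap f) := by
  rw [perturbedQuad_apply, map_add, lap_quad, hL.lap_comm]
  simp

theorem lap_perturbedQuad_mem {L : Poly →ₗ[ℂ] Poly} (hL : Admissible L) {n : ℕ} {f : Poly}
    (hf : f ∈ degLT n) : lap (perturbedQuad L f) ∈ degLT n := by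
  have h := lap_mem_degLT hf
  -- For n < 2 the bound through n - 2 + 2 would exceed n, but there the Laplacian of f vanishes.
  rcases Nat.lt_or_ge n 2 with hn | hn
  · have h0 : lap f = 0 := by
      apply eq_zero_of_mem_degLT_zero
      rwa [show n - 2 = 0 by omega] at h
    rw [lap_perturbedQuad hL, h0, map_zero, mul_zero, zero_add, add_zero]
    exact add_mem (Submodule.smul_mem _ _ (diagOp_mem_degLT _ hf)) (Submodule.smul_mem _ _ hf)
  rw [lap_perturbedQuad hL]
  refine add_mem (add_mem (add_mem ?_ (Submodule.smul_mem _ _ (diagOp_mem_degLT _ hf)))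
    (Submodule.smul_mem _ _ hf)) (hL.mem_degLT _ _ (degLT_mono (Nat.sub_le n 2) h))
  have := quad_mul_mem_degLT h
  rwa [Nat.sub_add_cancel hn] at this

theorem eq_zero_of_lap_perturbedQuad {L : Poly →ₗ[ℂ] Poly} (hL : Admissible L) {f : Poly}
    (h : lap (perturbedQuad L f) = 0) : f = 0 := by
  obtain ⟨n, hn⟩ := exists_mem_degLT f
  rw [lap_perturbedQuad hL] at h
  exact fischer_injective L hL.lap_comm n 1 2 (by norm_num) f hn h

/-- An injective endomorphism of the finite-dimensional space `degLT n` is surjective. -/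
theorem exists_lap_perturbedQuad_eq {L : Poly →ₗ[ℂ] Poly} (hL : Admissible L) {n : ℕ} {g : Poly}
    (hg : g ∈ degLT n) : ∃ f ∈ degLT n, lap (perturbedQuad L f) = g := by
  let A : degLT n →ₗ[ℂ] degLT n :=
    (lap ∘ₗ perturbedQuad L).restrict fun f hf => lap_perturbedQuad_mem hL hf
  have hinj : Function.Injective A := by
    rw [injective_iff_map_eq_zero]
    intro f hf
    have := congrArg Subtype.val hf
    exact Subtype.ext (eq_zero_of_lap_perturbedQuad hL this)
  obtain ⟨f, hf⟩ := (LinearMap.injective_iff_surjective.mp hinj) ⟨g, hg⟩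
  exact ⟨f, f.2, congrArg Subtype.val hf⟩

/-- The equation has a solution within the degree bound and only one solution overall. This later
bounds the degree of the quotient by K₀ - R̂. -/
theorem mem_degLT_of_lap_perturbedQuad_mem {L : Poly →ₗ[ℂ] Poly} (hL : Admissible L) {n : ℕ}
    {f : Poly} (h : lap (perturbedQuad L f) ∈ degLT n) : f ∈ degLT n := by
  obtain ⟨g, hg, he⟩ := exists_lap_perturbedQuad_eq hL h
  have : f - g = 0 := eq_zero_of_lap_perturbedQuad hL (by rw [map_sub, map_sub, he, sub_self])
  rwa [sub_eq_zero.mp this]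

/-- To split f, subtract the perturbed multiple of q that has the same Laplacian as f; it exists and
is unique by the preceding solvability. -/
theorem isCompl_harmonic {L : Poly →ₗ[ℂ] Poly} (hL : Admissible L) :
    IsCompl (LinearMap.ker lap) (LinearMap.range (perturbedQuad L)) := by
  constructor
  · rw [Submodule.disjoint_def]
    rintro _ hx ⟨w, rfl⟩
    rw [eq_zero_of_lap_perturbedQuad hL (LinearMap.mem_ker.mp hx), map_zero]
  · rw [codisjoint_iff, eq_top_iff]
    rintro f -
    obtain ⟨n, hn⟩ := exists_mem_degLT (lap f)
    obtain ⟨g, -, hg⟩ := exists_lap_perturbedQuad_eq hL hn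
    refine Submodule.mem_sup.mpr ⟨f - perturbedQuad L g, ?_, _, ⟨g, rfl⟩, sub_add_cancel _ _⟩
    rw [LinearMap.mem_ker, map_sub, hg, sub_self]

theorem admissible_zero : Admissible 0 := ⟨fun f => by simp, fun n f _ => by simp⟩

theorem exists_harmonic_add_quad_mul {n : ℕ} {f : Poly} (hf : f ∈ degLT n) :
    ∃ h g : Poly, lap h = 0 ∧ g ∈ degLT (n - 2) ∧ f = h + quad * g := by
  obtain ⟨g, hg, he⟩ := exists_lap_perturbedQuad_eq admissible_zero (lap_mem_degLT hf)
  refine ⟨f - quad * g, g, ?_, hg, by ring⟩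
  rw [map_sub, ← he]
  simp [perturbedQuad_apply]

end FuzzySphere
end

noncomputable section
namespace FuzzySphere
open MvPolynomial (X pderiv monomial coeff)

/-! ## Expansion of symmetric polynomials in their last letters -/

theorem word_append (l k : List Gen) : word (l ++ k) = word l * word k := by simp [word]

theorem symPoly_zero : symPoly 0 = 1 := by
  have : (0 : Multiset Gen).lists.toFinset = {[]} := by
    ext l
    rw [mem_symPoly]
    simp
  rw [symPoly, this]
  simp [word]

/-- The rearrangements of a multiset are sorted by their last letter, since the formal trace looks
only at the end of a word. -/
theorem symPoly_eq_sum_erase {m : Multiset Gen} (hm : m ≠ 0) :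
    symPoly m = ∑ g, if g ∈ m then symPoly (m.erase g) * letter g else 0 := by
  rw [← Finset.sum_filter]
  simp only [symPoly, Finset.sum_mul]
  rw [Finset.sum_sigma']
  symm
  refine Finset.sum_bij (fun x _ => x.2 ++ [x.1]) ?_ ?_ ?_ ?_
  · rintro ⟨g, l⟩ h
    simp only [Finset.mem_sigma, Finset.mem_filter, Finset.mem_univ, true_and, mem_symPoly] at h
    rw [mem_symPoly, ← Multiset.coe_add, h.2, Multiset.coe_singleton, add_comm,
      Multiset.singleton_add, Multiset.cons_erase h.1]
  · rintro ⟨g, l⟩ - ⟨h, k⟩ - e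
    have := List.append_inj' e rfl
    simp at this
    obtain ⟨rfl, rfl⟩ := this
    rfl
  · intro l hl
    rw [mem_symPoly] at hl
    rcases List.eq_nil_or_concat l with rfl | ⟨k, g, rfl⟩
    · exact absurd hl.symm hm
    · rw [List.concat_eq_append] at hl
      have hk : m = g ::ₘ (k : Multiset Gen) := by
        rw [← hl, ← Multiset.coe_add, Multiset.coe_singleton, add_comm, Multiset.singleton_add]
      refine ⟨⟨g, k⟩, ?_, by simp⟩
      simp only [Finset.mem_sigma, Finset.mem_filter, Finset.mem_univ, true_and, mem_symPoly]
      rw [hk]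
      simp
  · rintro ⟨g, l⟩ -
    simp [word]

theorem contract_mul_letter_mul_letter (x : FreeW) (g h : Gen) :
    contract (x * letter h * letter g) = if g = h.conj then x else 0 := by
  have hx : x ∈ Submodule.span ℂ (Set.range word) := by rw [span_word]; trivial
  induction hx using Submodule.span_induction with
  | mem x hx =>
    obtain ⟨l, rfl⟩ := hx
    have : word l * letter h * letter g = word (l ++ [h, g]) := by
      simp [word, mul_assoc]
    rw [this, contract_word]
    simp [contractWord]
  | zero => simp
  | add x y _ _ hx hy =>
    rw [add_mul, add_mul, map_add, hx, hy]
    split_ifs <;> simp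
  | smul c x _ hx =>
    rw [smul_mul_assoc, smul_mul_assoc, map_smul, hx]
    split_ifs <;> simp

theorem Gen.conj_conj (g : Gen) : g.conj.conj = g := by cases g <;> rfl

theorem contract_symPoly_mul_letter (m : Multiset Gen) (g : Gen) :
    contract (symPoly m * letter g) = if g.conj ∈ m then symPoly (m.erase g.conj) else 0 := by
  by_cases hm : m = 0
  · subst hm
    have : symPoly 0 * letter g = word [g] := by simp [symPoly_zero, word]
    rw [this, contract_word]
    simp [contractWord]
  · rw [symPoly_eq_sum_erase hm, Finset.sum_mul, map_sum, Finset.sum_eq_single g.conj]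
    · split_ifs
      · rw [contract_mul_letter_mul_letter, if_pos (Gen.conj_conj g).symm]
      · simp
    · intro h _ hh
      split_ifs
      · rw [contract_mul_letter_mul_letter, if_neg]
        rintro rfl
        exact hh (Gen.conj_conj h).symm
      · simp
    · simp

theorem contract_symPoly (m : Multiset Gen) :
    contract (symPoly m) = ∑ g : Gen, if g ∈ m ∧ g.conj ∈ m.erase g then
      symPoly ((m.erase g).erase g.conj) else 0 := by
  by_cases hm : m = 0
  · subst hm
    have : symPoly 0 = word [] := by simp [symPoly_zero, word]
    rw [this, contract_word]
    simp [contractWord]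
  · rw [symPoly_eq_sum_erase hm, map_sum]
    refine Finset.sum_congr rfl fun g _ => ?_
    by_cases hg : g ∈ m
    · rw [if_pos hg, contract_symPoly_mul_letter]
      simp [hg]
    · rw [if_neg hg, if_neg fun h => hg h.1, map_zero]

theorem tr_symBasis (ε : ℝ) (m : Multiset Gen) :
    tr ε (symBasis ε m) = ∑ g : Gen, if g ∈ m ∧ g.conj ∈ m.erase g then
      symBasis ε ((m.erase g).erase g.conj) else 0 := by
  have : tr ε (symBasis ε m) = toW ε (contract (symPoly m)) := by
    simp [tr, symRep, Module.Basis.constr_basis]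
  rw [this, contract_symPoly, map_sum]
  refine Finset.sum_congr rfl fun g _ => ?_
  split_ifs
  · rw [symBasis_apply]
  · rw [map_zero]

/-! ## The Weyl symbol -/

theorem W_induction {ε : ℝ} {p : W ε → Prop} (one : p 1) (gen_mul : ∀ g w, p w → p (gen ε g * w))
    (add : ∀ x y, p x → p y → p (x + y)) (smul : ∀ (c : ℂ) x, p x → p (c • x)) (w : W ε) : p w := by
  obtain ⟨y, rfl⟩ := RingQuot.mkAlgHom_surjective ℂ (Rel ε) w
  have hy : y ∈ Submodule.span ℂ (Set.range word) := by rw [span_word]; trivial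
  change p (toW ε y)
  induction hy using Submodule.span_induction with
  | mem x h =>
    obtain ⟨l, rfl⟩ := h
    induction l with
    | nil => simpa [word] using one
    | cons g l ih => rw [word_cons, map_mul]; exact gen_mul _ _ ih
  | zero => simpa using smul 0 _ one
  | add x y _ _ hx hy => rw [map_add]; exact add _ _ hx hy
  | smul c x _ hx => rw [map_smul]; exact smul _ _ hx

theorem actGen_apply (ε : ℝ) (g : Gen) (f : Poly) :
    actGen ε g f = X g * f - ((ε : ℂ) / 2 * g.sign) • pderiv g.conj f := rfl

/-- The right multiplication by a letter, on Weyl symbols. -/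
def ractGen (ε : ℝ) (g : Gen) : Poly →ₗ[ℂ] Poly :=
  LinearMap.mulLeft ℂ (X g) + ((ε : ℂ) / 2 * g.sign) • (pderiv g.conj).toLinearMap

theorem ractGen_apply (ε : ℝ) (g : Gen) (f : Poly) :
    ractGen ε g f = X g * f + ((ε : ℂ) / 2 * g.sign) • pderiv g.conj f := rfl

/-- Only conjugate letters produce cross terms, and these agree because conjugate letters have
opposite signs. -/
theorem actGen_ractGen (ε : ℝ) (g h : Gen) (f : Poly) :
    actGen ε g (ractGen ε h f) = ractGen ε h (actGen ε g f) := by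
  simp only [actGen_apply, ractGen_apply, map_add, map_sub, map_smul, Derivation.leibniz,
    smul_eq_mul, pderiv_X_apply, pderiv_comm_apply g.conj h.conj]
  cases g <;> cases h <;> simp [Gen.conj, Gen.sign, MvPolynomial.smul_eq_C_mul] <;> ring

theorem act_gen_mul (ε : ℝ) (g : Gen) (w : W ε) (f : Poly) :
    act ε (gen ε g * w) f = actGen ε g (act ε w f) := by
  rw [map_mul, act_gen]; rfl

theorem act_ractGen (ε : ℝ) (g : Gen) (w : W ε) (f : Poly) :
    act ε w (ractGen ε g f) = ractGen ε g (act ε w f) := by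
  induction w using W_induction with
  | one => simp
  | gen_mul h w ih => rw [act_gen_mul, act_gen_mul, ih, actGen_ractGen]
  | add x y hx hy => simp [hx, hy]
  | smul c x hx => simp [hx]

/-- Left and right operators of a letter agree on the vector 1, and the right operator commutes with
the action of w; hence it can be pulled out in front. -/
theorem act_mul_gen (ε : ℝ) (g : Gen) (w : W ε) :
    act ε (w * gen ε g) 1 = ractGen ε g (act ε w 1) := by
  rw [map_mul, Module.End.mul_apply, act_gen, ← act_ractGen]
  congr 1
  simp [actGen_apply, ractGen_apply]

/-- The number of words with a given multiset of letters. -/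
def multinom (m : Multiset Gen) : ℂ := (m.card.factorial : ℂ) / ∏ g : Gen, ((m.count g).factorial : ℂ)

theorem multinom_ne_zero (m : Multiset Gen) : multinom m ≠ 0 :=
  div_ne_zero (by exact_mod_cast Nat.factorial_ne_zero _)
    (Finset.prod_ne_zero_iff.mpr fun g _ => by exact_mod_cast Nat.factorial_ne_zero _)

theorem card_mul_multinom_erase {m : Multiset Gen} {g : Gen} (hg : g ∈ m) :
    (m.card : ℂ) * multinom (m.erase g) = m.count g * multinom m := by
  obtain ⟨k, rfl⟩ := Multiset.exists_cons_of_mem hg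
  have h1 : ∏ h : Gen, (((g ::ₘ k).count h).factorial : ℂ) =
      ((k.count g : ℂ) + 1) * ∏ h : Gen, ((k.count h).factorial : ℂ) := by
    rw [← Finset.mul_prod_erase Finset.univ _ (Finset.mem_univ g),
      ← Finset.mul_prod_erase Finset.univ (fun h => ((k.count h).factorial : ℂ))
      (Finset.mem_univ g), Multiset.count_cons_self, Nat.factorial_succ]
    push_cast
    rw [mul_assoc]
    congr 2
    refine Finset.prod_congr rfl fun h hh => ?_
    rw [Multiset.count_cons_of_ne (Finset.ne_of_mem_erase hh)]
  have h2 : (∏ h : Gen, ((k.count h).factorial : ℂ)) ≠ 0 :=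
    Finset.prod_ne_zero_iff.mpr fun g _ => by exact_mod_cast Nat.factorial_ne_zero _
  have h3 : ((k.count g : ℂ) + 1) ≠ 0 := Nat.cast_add_one_ne_zero _
  rw [Multiset.erase_cons_head, multinom, multinom, h1, Multiset.count_cons_self,
    Multiset.card_cons, Nat.factorial_succ]
  push_cast
  field_simp

/-- The monomial with a given multiset of letters. -/
def mono (m : Multiset Gen) : Poly := monomial (Multiset.toFinsupp m) 1

theorem X_mul_mono_erase {m : Multiset Gen} {g : Gen} (hg : g ∈ m) :
    X g * mono (m.erase g) = mono m := by
  obtain ⟨k, rfl⟩ := Multiset.exists_cons_of_mem hg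
  rw [Multiset.erase_cons_head, mono, mono, MvPolynomial.X, MvPolynomial.monomial_mul,
    ← Multiset.singleton_add, map_add, Multiset.toFinsupp_singleton, one_mul]

theorem toFinsupp_erase (m : Multiset Gen) (g : Gen) :
    Multiset.toFinsupp (m.erase g) = Multiset.toFinsupp m - Finsupp.single g 1 := by
  ext h
  by_cases hh : g = h
  · subst hh; simp
  · simp [hh, Multiset.count_erase_of_ne (Ne.symm hh)]

theorem pderiv_mono (m : Multiset Gen) (g : Gen) :
    pderiv g (mono m) = (m.count g : ℂ) • mono (m.erase g) := by
  rw [mono, mono, MvPolynomial.pderiv_monomial, toFinsupp_erase, MvPolynomial.smul_monomial]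
  simp

/-- The terms of g and of its conjugate contain the same second derivative with opposite signs. This
cancellation is why symmetric ordering produces no ε-correction. -/
theorem sum_sign_pair (m : Multiset Gen) :
    ∑ g : Gen, ((m.count g : ℂ) * g.sign) • pderiv g.conj (mono (m.erase g)) = 0 := by
  have h : ∀ g h : Gen, g ≠ h → pderiv h (mono (m.erase g)) =
      (m.count h : ℂ) • mono ((m.erase g).erase h) := by
    intro g h hgh
    rw [pderiv_mono, Multiset.count_erase_of_ne hgh.symm]
  rw [sum_gen]
  simp only [Gen.conj, Gen.sign]
  rw [h .am .ap (by simp), h .ap .am (by simp), h .bm .bp (by simp), h .bp .bm (by simp),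
    Multiset.erase_comm m .am .ap, Multiset.erase_comm m .bm .bp]
  module

/-- Induction on the number of letters: split off the last letter and let it act from the right. The
multiplication parts add up to the multinomial coefficient, and the derivative parts cancel by
`sum_sign_pair`. -/
theorem act_symBasis (ε : ℝ) (m : Multiset Gen) :
    act ε (symBasis ε m) 1 = multinom m • mono m := by
  induction hn : m.card using Nat.strong_induction_on generalizing m with
  | _ n ih =>
  subst hn
  by_cases hm : m = 0
  · subst hm
    rw [symBasis_apply, symPoly_zero, map_one (toW ε), map_one (act ε), Module.End.one_apply]
    simp [multinom, mono]
  have hc : (m.card : ℂ) ≠ 0 := by exact_mod_cast fun h => hm (Multiset.card_eq_zero.mp h)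
  rw [symBasis_apply, symPoly_eq_sum_erase hm, map_sum, map_sum, LinearMap.sum_apply]
  have key : ∀ g : Gen, act ε (toW ε (if g ∈ m then symPoly (m.erase g) * letter g else 0)) 1 =
      (multinom m / m.card) • ((m.count g : ℂ) • mono m) + ((multinom m / m.card) * (ε / 2)) •
        ((m.count g : ℂ) * g.sign) • pderiv g.conj (mono (m.erase g)) := by
    intro g
    split_ifs with hg
    · have e : multinom (m.erase g) = multinom m / m.card * m.count g := by
        rw [div_mul_eq_mul_div, eq_div_iff hc, mul_comm, card_mul_multinom_erase hg, mul_comm]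
      rw [map_mul]
      have h1 := act_mul_gen ε g (toW ε (symPoly (m.erase g)))
      rw [gen] at h1
      rw [h1, ← symBasis_apply, ih _ (Multiset.card_erase_lt_of_mem hg) _ rfl, map_smul,
        ractGen_apply, X_mul_mono_erase hg, e]
      module
    · have : m.count g = 0 := Multiset.count_eq_zero.mpr hg
      simp [this]
  simp only [key]
  rw [Finset.sum_add_distrib, ← Finset.smul_sum, ← Finset.smul_sum, sum_sign_pair, smul_zero,
    add_zero, ← Finset.sum_smul]
  have hs : ∑ g : Gen, (m.count g : ℂ) = m.card := by
    exact_mod_cast Multiset.sum_count_eq_card (s := Finset.univ) (m := m) (by simp)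
  rw [hs, smul_smul, div_mul_cancel₀ _ hc]

/-- The Weyl symbols of the basis `S(s,t,u,v)`. -/
def symbolBasis : Module.Basis (Multiset Gen) ℂ Poly :=
  ((MvPolynomial.basisMonomials Gen ℂ).reindex Multiset.toFinsupp.toEquiv.symm).unitsSMul
    fun m => Units.mk0 _ (multinom_ne_zero m)

theorem symbolBasis_apply (m : Multiset Gen) : symbolBasis m = multinom m • mono m := by
  rw [symbolBasis, Module.Basis.unitsSMul_apply, Module.Basis.reindex_apply,
    MvPolynomial.coe_basisMonomials]
  rfl

/-- The Weyl symbol. -/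
def symbol (ε : ℝ) : W ε ≃ₗ[ℂ] Poly := (symBasis ε).equiv symbolBasis (Equiv.refl _)

theorem symbol_symBasis (ε : ℝ) (m : Multiset Gen) :
    symbol ε (symBasis ε m) = multinom m • mono m := by
  simp [symbol, symbolBasis_apply]

/-- Reconciles the two descriptions of the symbol: as a map of bases it is bijective, and as the
orbit map of the vector 1 it is compatible with products. -/
theorem symbol_apply (ε : ℝ) (w : W ε) : symbol ε w = act ε w 1 := by
  have : (symbol ε).toLinearMap = LinearMap.applyₗ 1 ∘ₗ (act ε).toLinearMap := by
    refine (symBasis ε).ext fun m => ?_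
    simp [symbol_symBasis, act_symBasis]
  exact LinearMap.congr_fun this w

theorem symbol_gen_mul (ε : ℝ) (g : Gen) (w : W ε) :
    symbol ε (gen ε g * w) = actGen ε g (symbol ε w) := by
  rw [symbol_apply, symbol_apply, act_gen_mul]

theorem symbol_mul_gen (ε : ℝ) (g : Gen) (w : W ε) :
    symbol ε (w * gen ε g) = ractGen ε g (symbol ε w) := by
  rw [symbol_apply, symbol_apply, act_mul_gen]

theorem symbol_one (ε : ℝ) : symbol ε 1 = 1 := by rw [symbol_apply, map_one (act ε), Module.End.one_apply]

/-! ### Grading and formal trace on Weyl symbols -/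

theorem diagOp_monomial (c : Gen → ℂ) (d : Gen →₀ ℕ) (a : ℂ) :
    diagOp c (monomial d a) = (∑ g, c g * d g) • monomial d a := by
  ext e
  rw [coeff_diagOp, MvPolynomial.coeff_smul, MvPolynomial.coeff_monomial]
  split_ifs with h
  · subst h; rfl
  · simp

theorem euler_mono (m : Multiset Gen) : euler (mono m) = (m.card : ℂ) • mono m := by
  rw [euler, mono, diagOp_monomial]
  congr 1
  simp only [one_mul, Multiset.toFinsupp_apply]
  exact_mod_cast Multiset.sum_count_eq_card (s := Finset.univ) (m := m) (by simp)

theorem wt_toFinsupp (m : Multiset Gen) : wt (Multiset.toFinsupp m) = (m.map Gen.sign).sum := by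
  rw [Finset.sum_multiset_map_count, wt,
    ← Finset.sum_subset (Finset.subset_univ m.toFinset) fun g _ hg => ?_]
  · exact Finset.sum_congr rfl fun g _ => by rw [Multiset.toFinsupp_apply, nsmul_eq_mul, mul_comm]
  · rw [Multiset.mem_toFinset] at hg
    simp [hg]

theorem wtOp_mono (m : Multiset Gen) : wtOp (mono m) = (m.map Gen.sign).sum • mono m := by
  rw [← wt_toFinsupp, wtOp, mono, diagOp_monomial, wt]

theorem symbol_adK0 (ε : ℝ) (w : W ε) :
    symbol ε (adK0 ε w) = (1 / 2 : ℂ) • wtOp (symbol ε w) := by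
  have : (symbol ε).toLinearMap ∘ₗ adK0 ε =
      (1 / 2 : ℂ) • wtOp ∘ₗ (symbol ε).toLinearMap := by
    refine (symBasis ε).ext fun m => ?_
    simp only [LinearMap.comp_apply, LinearMap.smul_apply, LinearEquiv.coe_coe, adK0,
      Module.Basis.constr_basis, map_smul, symbol_symBasis, wtOp_mono]
    module
  exact LinearMap.congr_fun this w

/-- `(E + 1)(E + 2)` for the Euler operator `E`. -/
def eulerSq : Poly →ₗ[ℂ] Poly := euler ∘ₗ euler + (3 : ℂ) • euler + (2 : ℂ) • LinearMap.id

theorem eulerSq_apply (f : Poly) :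
    eulerSq f = euler (euler f) + (3 : ℂ) • euler f + (2 : ℂ) • f := rfl

theorem eulerSq_eq_zero {f : Poly} (h : eulerSq f = 0) : f = 0 := by
  ext d
  have h1 := congrArg (coeff d) h
  simp only [eulerSq_apply, MvPolynomial.coeff_add, MvPolynomial.coeff_smul, coeff_euler, smul_eq_mul,
    MvPolynomial.coeff_zero] at h1
  have h2 : (((d.degree + 1) * (d.degree + 2) : ℕ) : ℂ) * coeff d f = 0 := by
    rw [← h1]; push_cast; ring
  rw [MvPolynomial.coeff_zero]
  refine (mul_eq_zero.mp h2).resolve_left ?_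
  exact_mod_cast (by positivity : (d.degree + 1) * (d.degree + 2) ≠ 0)

theorem pderiv_pderiv_conj_mono (m : Multiset Gen) (g : Gen) :
    pderiv g (pderiv g.conj (mono m)) =
      ((m.count g : ℂ) * m.count g.conj) • mono ((m.erase g).erase g.conj) := by
  have hg : g.conj ≠ g := by cases g <;> simp [Gen.conj]
  rw [pderiv_comm_apply, pderiv_mono, Derivation.map_smul, pderiv_mono, Multiset.count_erase_of_ne hg,
    smul_smul]

/-- Deleting a conjugate pair from n letters multiplies the multinomial coefficient by the product
of the two counts over n(n - 1). That denominator is the eigenvalue of (E+1)(E+2) in degree n - 2,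
and the numerator comes from the two derivatives. The factor 2 arises because each pair occurs in
both orders. -/
theorem eulerSq_symbol_tr (ε : ℝ) (w : W ε) :
    eulerSq (symbol ε (tr ε w)) = (2 : ℂ) • lap (symbol ε w) := by
  have : eulerSq ∘ₗ (symbol ε).toLinearMap ∘ₗ tr ε = (2 : ℂ) • lap ∘ₗ (symbol ε).toLinearMap := by
    refine (symBasis ε).ext fun m => ?_
    have key : ∀ g : Gen, eulerSq (symbol ε (if g ∈ m ∧ g.conj ∈ m.erase g then
          symBasis ε ((m.erase g).erase g.conj) else 0)) =
        multinom m • pderiv g (pderiv g.conj (mono m)) := by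
      intro g
      have hg : g.conj ≠ g := by cases g <;> simp [Gen.conj]
      rw [pderiv_pderiv_conj_mono, ← Multiset.count_erase_of_ne hg m]
      split_ifs with h
      · have e1 := card_mul_multinom_erase h.1
        have e2 := card_mul_multinom_erase h.2
        have c1 := Multiset.card_erase_add_one h.1
        have c2 := Multiset.card_erase_add_one h.2
        have c1' : (m.card : ℂ) = (m.erase g).card + 1 := by exact_mod_cast c1.symm
        have c2' : ((m.erase g).card : ℂ) = ((m.erase g).erase g.conj).card + 1 := by
          exact_mod_cast c2.symm
        rw [symbol_symBasis]
        simp only [eulerSq_apply, map_smul, euler_mono, smul_smul, ← add_smul]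
        congr 1
        rw [c1'] at e1
        rw [c2'] at e1 e2
        linear_combination ((m.erase g).count g.conj : ℂ) * e1 +
          ((((m.erase g).erase g.conj).card : ℂ) + 1 + 1) * e2
      · rw [not_and_or] at h
        have : (m.count g : ℂ) * (m.erase g).count g.conj = 0 := by
          rcases h with h | h
          · simp [Multiset.count_eq_zero.mpr h]
          · simp [Multiset.count_eq_zero.mpr h]
        rw [this]
        simp
    simp only [LinearMap.comp_apply, LinearMap.smul_apply, LinearEquiv.coe_coe, tr_symBasis, map_sum, key, symbol_symBasis, map_smul]
    rw [sum_gen, lap_apply]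
    simp only [Gen.conj, pderiv_comm_apply .am .ap, pderiv_comm_apply .bm .bp]
    module
  exact LinearMap.congr_fun this w

theorem mem_Psi_iff (ε : ℝ) (w : W ε) : w ∈ Psi ε ↔ lap (symbol ε w) = 0 := by
  rw [Psi, LinearMap.mem_ker]
  have h := eulerSq_symbol_tr ε w
  constructor
  · intro h0
    rw [h0] at h
    simpa using h.symm
  · intro h0
    rw [h0, smul_zero] at h
    exact (LinearEquiv.map_eq_zero_iff _).mp (eulerSq_eq_zero h)

/-! ## Multiplication by `K₀ - R̂` on Weyl symbols -/

/-- The lower order part of the multiplication by `2 (K₀ - R̂)`. -/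
def lowerOp (ε R : ℝ) (s : ℂ) : Poly →ₗ[ℂ] Poly :=
  (s * ε) • wtOp - ((ε : ℂ) ^ 2 / 4) • lap - (2 * (Rhat ε R : ℂ)) • LinearMap.id

theorem lowerOp_apply (ε R : ℝ) (s : ℂ) (f : Poly) : lowerOp ε R s f =
    (s * ε) • wtOp f - ((ε : ℂ) ^ 2 / 4) • lap f - (2 * (Rhat ε R : ℂ)) • f := rfl

/-- The weight operator commutes with the Laplacian because every term of the latter removes letters
of total weight zero. -/
theorem admissible_lowerOp (ε R : ℝ) (s : ℂ) : Admissible (lowerOp ε R s) where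
  lap_comm f := by simp only [lowerOp_apply, map_sub, map_smul, lap_wtOp]
  mem_degLT n f hf := by
    rw [lowerOp_apply]
    exact sub_mem (sub_mem (Submodule.smul_mem _ _ (diagOp_mem_degLT _ hf))
      (Submodule.smul_mem _ _ (degLT_mono (Nat.sub_le n 2) (lap_mem_degLT hf))))
      (Submodule.smul_mem _ _ hf)

/-- Composing the right operators gives an ordering constant -ε/2 for each of the two pairs; the
summand ε in 2K₀ cancels both, so no constant beyond -2R̂ remains. -/
theorem symbol_mul_K0_sub (ε R : ℝ) (w : W ε) :
    symbol ε (w * (K0 ε - algebraMap ℂ (W ε) (Rhat ε R : ℂ))) =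
      (1 / 2 : ℂ) • perturbedQuad (lowerOp ε R (-1 / 2)) (symbol ε w) := by
  have e : w * (K0 ε - algebraMap ℂ (W ε) (Rhat ε R : ℂ)) = (1 / 2 : ℂ) •
      (w * gen ε .ap * gen ε .am + w * gen ε .bp * gen ε .bm + (ε : ℂ) • w) -
      (Rhat ε R : ℂ) • w := by
    rw [K0, mul_sub, mul_smul_comm, mul_add, mul_add, ← Algebra.commutes, ← Algebra.commutes,
      ← Algebra.smul_def, ← Algebra.smul_def, mul_assoc, mul_assoc]
  rw [e]
  simp only [map_sub, map_smul, map_add, symbol_mul_gen, perturbedQuad_apply, lowerOp_apply,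
    ractGen_apply, wtOp, diagOp_apply, lap_apply, quad, Derivation.leibniz, pderiv_X_apply,
    Gen.conj, Gen.sign, smul_eq_mul, add_mul, if_true,
    mul_one, ← mul_assoc, mul_comm (X Gen.am) (X Gen.ap), mul_comm (X Gen.bm) (X Gen.bp)]
  module

/-- Left multiplication differs from right multiplication by Ad K₀, which only turns the weight
coefficient -1/2 into 1/2. -/
theorem symbol_K0_sub_mul (ε R : ℝ) (w : W ε) :
    symbol ε ((K0 ε - algebraMap ℂ (W ε) (Rhat ε R : ℂ)) * w) =
      (1 / 2 : ℂ) • perturbedQuad (lowerOp ε R (1 / 2)) (symbol ε w) := by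
  have e : (K0 ε - algebraMap ℂ (W ε) (Rhat ε R : ℂ)) * w =
      w * (K0 ε - algebraMap ℂ (W ε) (Rhat ε R : ℂ)) + (ε : ℂ) • adK0 ε w := by
    rw [smul_adK0, sub_mul, mul_sub, Algebra.commutes]
    abel
  rw [e, map_add, symbol_mul_K0_sub, map_smul, symbol_adK0]
  simp only [perturbedQuad_apply, lowerOp_apply]
  module

end FuzzySphere
end

noncomputable section
namespace FuzzySphere
open MvPolynomial (X pderiv monomial coeff)

/-! ## Properties of the projections -/

/-- `K₀ - R̂`. -/
def kShift (ε R : ℝ) : W ε := K0 ε - algebraMap ℂ (W ε) (Rhat ε R : ℂ)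

theorem mem_kerRho {ε R : ℝ} {x : W ε} : x ∈ kerRho ε R ↔ ∃ u, u * kShift ε R = x := Iff.rfl

theorem symbol_mul_kShift (ε R : ℝ) (w : W ε) : symbol ε (w * kShift ε R) =
    (1 / 2 : ℂ) • perturbedQuad (lowerOp ε R (-1 / 2)) (symbol ε w) :=
  symbol_mul_K0_sub ε R w

theorem symbol_kShift_mul (ε R : ℝ) (w : W ε) : symbol ε (kShift ε R * w) =
    (1 / 2 : ℂ) • perturbedQuad (lowerOp ε R (1 / 2)) (symbol ε w) :=
  symbol_K0_sub_mul ε R w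

theorem isCompl_Psi_of_symbol {ε : ℝ} (A : W ε →ₗ[ℂ] W ε) {L : Poly →ₗ[ℂ] Poly}
    (hL : Admissible L)
    (hA : ∀ w, symbol ε (A w) = (1 / 2 : ℂ) • perturbedQuad L (symbol ε w)) :
    IsCompl (Psi ε) (LinearMap.range A) := by
  have h := (Submodule.orderIsoMapComap (symbol ε)).symm.isCompl (isCompl_harmonic hL)
  have e₁ : Psi ε = (Submodule.orderIsoMapComap (symbol ε)).symm (LinearMap.ker lap) := by
    ext x
    exact mem_Psi_iff ε x
  have e₂ : LinearMap.range A =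
      (Submodule.orderIsoMapComap (symbol ε)).symm (LinearMap.range (perturbedQuad L)) := by
    ext x
    constructor
    · rintro ⟨w, rfl⟩
      exact ⟨(1 / 2 : ℂ) • symbol ε w, by rw [map_smul]; exact (hA w).symm⟩
    · rintro ⟨f, hf⟩
      refine ⟨(2 : ℂ) • (symbol ε).symm f, (symbol ε).injective ?_⟩
      rw [hA, map_smul, LinearEquiv.apply_symm_apply, map_smul, smul_smul, hf]
      norm_num
  rw [e₁, e₂]
  exact h

theorem isCompl_kerRho (ε R : ℝ) : IsCompl (Psi ε) (kerRho ε R) :=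
  isCompl_Psi_of_symbol _ (admissible_lowerOp ε R _) (symbol_mul_kShift ε R)

theorem isCompl_kerRhoStar (ε R : ℝ) : IsCompl (Psi ε) (kerRhoStar ε R) :=
  isCompl_Psi_of_symbol _ (admissible_lowerOp ε R _) (symbol_kShift_mul ε R)

theorem projection_eq_of_sub_mem {M : Type*} [AddCommGroup M] [Module ℂ M] {p q : Submodule ℂ M}
    (h : IsCompl p q) {x w : M} (hx : x ∈ p) (hw : w - x ∈ q) : p.projection q h w = x := by
  have e : w = x + (w - x) := by abel
  have h2 : p.projection q h (w - x) = 0 := by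
    rw [← LinearMap.mem_ker]
    simpa using hw
  rw [e, map_add, h2, add_zero, Submodule.projection_apply_of_mem_left h hx]

theorem sub_projection_mem {M : Type*} [AddCommGroup M] [Module ℂ M] {p q : Submodule ℂ M}
    (h : IsCompl p q) (w : M) : w - p.projection q h w ∈ q := by
  have h2 : p.projection q h (w - p.projection q h w) = 0 := by
    rw [map_sub, Submodule.projection_apply_of_mem_left h (Submodule.projection_apply_mem h w),
      sub_self]
  rw [← LinearMap.mem_ker] at h2
  simpa using h2

theorem rho_eq (ε R : ℝ) :
    rho ε R = (Psi ε).projection (kerRho ε R) (isCompl_kerRho ε R) := by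
  rw [rho, dif_pos]

theorem rhoStar_eq (ε R : ℝ) :
    rhoStar ε R = (Psi ε).projection (kerRhoStar ε R) (isCompl_kerRhoStar ε R) := by
  rw [rhoStar, dif_pos]

theorem rho_mem (ε R : ℝ) (w : W ε) : rho ε R w ∈ Psi ε := by
  rw [rho_eq]; exact Submodule.projection_apply_mem _ _

theorem rho_eq_of_mem {ε R : ℝ} {x w : W ε} (hx : x ∈ Psi ε) (hw : w - x ∈ kerRho ε R) :
    rho ε R w = x := by
  rw [rho_eq]; exact projection_eq_of_sub_mem _ hx hw

theorem rhoStar_eq_of_mem {ε R : ℝ} {x w : W ε} (hx : x ∈ Psi ε) (hw : w - x ∈ kerRhoStar ε R) :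
    rhoStar ε R w = x := by
  rw [rhoStar_eq]; exact projection_eq_of_sub_mem _ hx hw

theorem rho_of_mem {ε R : ℝ} {x : W ε} (hx : x ∈ Psi ε) : rho ε R x = x :=
  rho_eq_of_mem hx (by simp)

theorem exists_eq_rho_add (ε R : ℝ) (w : W ε) : ∃ u, w = rho ε R w + u * kShift ε R := by
  have := sub_projection_mem (isCompl_kerRho ε R) w
  rw [← rho_eq] at this
  obtain ⟨u, hu⟩ := mem_kerRho.mp this
  exact ⟨u, by rw [hu]; abel⟩

theorem rho_mul_kShift (ε R : ℝ) (u : W ε) : rho ε R (u * kShift ε R) = 0 :=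
  rho_eq_of_mem (zero_mem _) (by rw [sub_zero]; exact ⟨u, rfl⟩)

/-- The kernel of ρ is a left ideal. -/
theorem rho_mul_rho (ε R : ℝ) (w₁ w₂ : W ε) :
    rho ε R (w₁ * rho ε R w₂) = rho ε R (w₁ * w₂) := by
  obtain ⟨u, hu⟩ := exists_eq_rho_add ε R w₂
  conv_rhs => rw [hu, mul_add, ← mul_assoc, map_add, rho_mul_kShift, add_zero]

/-- Uniqueness in the Fischer decomposition makes the quotient by K₀ - R̂ well defined, so that it
inherits the weight of the dividend. -/
theorem mul_kShift_injective {ε R : ℝ} {u : W ε} (h : u * kShift ε R = 0) : u = 0 := by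
  have h1 := congrArg (symbol ε) h
  rw [symbol_mul_kShift, map_zero, smul_eq_zero] at h1
  have h2 := h1.resolve_left (by norm_num)
  have := eq_zero_of_lap_perturbedQuad (admissible_lowerOp ε R _) (by rw [h2, map_zero])
  exact (LinearEquiv.map_eq_zero_iff _).mp this

/-! ## The grading -/

theorem wt_add_single (d : Gen →₀ ℕ) (g : Gen) : wt (d + Finsupp.single g 1) = wt d + g.sign := by
  simp only [wt, Finsupp.add_apply, Nat.cast_add, mul_add, Finset.sum_add_distrib]
  congr 1
  rw [Finset.sum_eq_single g]
  · simp
  · intro h _ hh; simp [hh.symm]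
  · simp

theorem wtOp_X_mul (g : Gen) (f : Poly) : wtOp (X g * f) = g.sign • (X g * f) + X g * wtOp f := by
  have h : wtOp (X g) = g.sign • X g := by
    rw [wtOp, MvPolynomial.X, diagOp_monomial]
    have := wt_add_single 0 g
    simp only [zero_add] at this
    change wt _ • _ = _
    rw [this]
    simp [wt]
  rw [wtOp_mul, h, smul_mul_assoc]

theorem wtOp_pderiv (g : Gen) (f : Poly) :
    wtOp (pderiv g f) = pderiv g (wtOp f) - g.sign • pderiv g f := by
  ext d
  simp only [coeff_wtOp, MvPolynomial.coeff_sub, MvPolynomial.coeff_smul, MvPolynomial.coeff_pderiv,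
    wt_add_single, smul_eq_mul]
  ring

theorem Gen.sign_conj (g : Gen) : g.conj.sign = -g.sign := by cases g <;> simp [Gen.conj, Gen.sign]

theorem wtOp_actGen (ε : ℝ) (g : Gen) (f : Poly) :
    wtOp (actGen ε g f) = g.sign • actGen ε g f + actGen ε g (wtOp f) := by
  simp only [actGen_apply, map_sub, map_smul, wtOp_X_mul, wtOp_pderiv, Gen.sign_conj]
  module

theorem adK0_gen_mul (ε : ℝ) (g : Gen) (w : W ε) :
    adK0 ε (gen ε g * w) = (g.sign / 2) • (gen ε g * w) + gen ε g * adK0 ε w := by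
  apply (symbol ε).injective
  simp only [symbol_adK0, map_add, map_smul, symbol_gen_mul, wtOp_actGen]
  module

theorem adK0_one (ε : ℝ) : adK0 ε 1 = 0 := by
  apply (symbol ε).injective
  rw [symbol_adK0, symbol_one, map_zero]
  have : (1 : Poly) = mono 0 := by simp [mono]
  rw [this, wtOp_mono]
  simp

/-- For ε = 0 the commutator carries no information, so the derivation property is obtained for all
ε at once from the action on letters. -/
theorem adK0_mul (ε : ℝ) (x y : W ε) : adK0 ε (x * y) = adK0 ε x * y + x * adK0 ε y := by
  induction x using W_induction with
  | one => rw [one_mul, one_mul, adK0_one, zero_mul, zero_add]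
  | gen_mul g x ih =>
    rw [mul_assoc, adK0_gen_mul, ih, adK0_gen_mul, add_mul, smul_mul_assoc, mul_add, mul_assoc,
      mul_assoc, mul_assoc, add_assoc]
  | add x x' hx hx' =>
    rw [add_mul, map_add, hx, hx', map_add]; noncomm_ring
  | smul c x hx => rw [smul_mul_assoc, map_smul, hx, map_smul]; simp

theorem adK0_gen (ε : ℝ) (g : Gen) : adK0 ε (gen ε g) = (g.sign / 2) • gen ε g := by
  have := adK0_gen_mul ε g 1
  rwa [mul_one, adK0_one, mul_zero, add_zero] at this

theorem adK0_gen_mul_gen (ε : ℝ) {g h : Gen} (hs : g.sign + h.sign = 0) :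
    adK0 ε (gen ε g * gen ε h) = 0 := by
  rw [adK0_mul, adK0_gen, adK0_gen, smul_mul_assoc, mul_smul_comm, ← add_smul, ← add_div, hs,
    zero_div, zero_smul]

theorem adK0_algebraMap (ε : ℝ) (c : ℂ) : adK0 ε (algebraMap ℂ (W ε) c) = 0 := by
  rw [Algebra.algebraMap_eq_smul_one, map_smul, adK0_one, smul_zero]

theorem adK0_kShift (ε R : ℝ) : adK0 ε (kShift ε R) = 0 := by
  have h1 := adK0_gen_mul_gen ε (g := .ap) (h := .am) (by simp [Gen.sign])
  have h2 := adK0_gen_mul_gen ε (g := .bp) (h := .bm) (by simp [Gen.sign])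
  simp [kShift, K0, adK0_algebraMap, h1, h2]

theorem adK0_mul_kShift (ε R : ℝ) (u : W ε) :
    adK0 ε (u * kShift ε R) = adK0 ε u * kShift ε R := by
  rw [adK0_mul, adK0_kShift, mul_zero, add_zero]

theorem adK0_mem_Psi {ε : ℝ} {x : W ε} (hx : x ∈ Psi ε) : adK0 ε x ∈ Psi ε := by
  rw [mem_Psi_iff] at *
  rw [symbol_adK0, map_smul, lap_wtOp, hx, map_zero, smul_zero]

/-- The grading operator preserves both Ψ and the kernel of ρ, as K₀ - R̂ has weight zero. -/
theorem adK0_rho (ε R : ℝ) (w : W ε) : adK0 ε (rho ε R w) = rho ε R (adK0 ε w) := by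
  obtain ⟨u, hu⟩ := exists_eq_rho_add ε R w
  symm
  apply rho_eq_of_mem (adK0_mem_Psi (rho_mem ε R w))
  refine ⟨adK0 ε u, ?_⟩
  change adK0 ε u * kShift ε R = _
  rw [← adK0_mul_kShift, ← map_sub]
  congr 1
  exact eq_sub_of_add_eq' hu.symm

theorem mul_kShift_comm {ε : ℝ} (R : ℝ) {x : W ε} (hx : adK0 ε x = 0) :
    kShift ε R * x = x * kShift ε R := by
  have h := smul_adK0 ε x
  rw [hx, smul_zero] at h
  rw [kShift, sub_mul, mul_sub, Algebra.commutes, sub_eq_zero.mp h.symm]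

/-- Weight-zero elements commute with K₀ - R̂, so the kernel of ρ is stable under right
multiplication by them. -/
theorem rho_rho_mul {ε R : ℝ} (w : W ε) {x : W ε} (hx : adK0 ε x = 0) :
    rho ε R (rho ε R w * x) = rho ε R (w * x) := by
  obtain ⟨u, hu⟩ := exists_eq_rho_add ε R w
  conv_rhs => rw [hu, add_mul, mul_assoc, mul_kShift_comm R hx, ← mul_assoc, map_add,
    rho_mul_kShift, add_zero]

/-- In x = ρ(x) + u(K₀ - R̂) the quotient u has weight zero too, hence commutes with K₀ - R̂; the
same decomposition then serves for ρ⋆. -/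
theorem rhoStar_eq_rho {ε R : ℝ} {x : W ε} (hx : adK0 ε x = 0) : rhoStar ε R x = rho ε R x := by
  obtain ⟨u, hu⟩ := exists_eq_rho_add ε R x
  have h0 : adK0 ε u = 0 := by
    apply mul_kShift_injective (R := R)
    rw [← adK0_mul_kShift, ← sub_eq_of_eq_add' hu, map_sub, adK0_rho, hx, map_zero, sub_self]
  apply rhoStar_eq_of_mem (rho_mem ε R x)
  refine ⟨u, ?_⟩
  change kShift ε R * u = _
  rw [mul_kShift_comm R h0]
  exact (sub_eq_of_eq_add' hu).symm

theorem mem_PsiR {ε r : ℝ} {x : W ε} : x ∈ PsiR ε r ↔ x ∈ Psi ε ∧ adK0 ε x = (r : ℂ) • x := by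
  rw [PsiR, Submodule.mem_inf, LinearMap.mem_ker, LinearMap.sub_apply, sub_eq_zero]
  rfl

theorem mem_PsiR_zero {ε : ℝ} {x : W ε} : x ∈ PsiR ε 0 ↔ x ∈ Psi ε ∧ adK0 ε x = 0 := by
  rw [mem_PsiR]; simp

theorem adK0_mul_of_mem {ε r₁ r₂ : ℝ} {x y : W ε} (hx : x ∈ PsiR ε r₁) (hy : y ∈ PsiR ε r₂) :
    adK0 ε (x * y) = ((r₂ + r₁ : ℝ) : ℂ) • (x * y) := by
  rw [adK0_mul, (mem_PsiR.mp hx).2, (mem_PsiR.mp hy).2, smul_mul_assoc, mul_smul_comm]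
  push_cast
  module

theorem rho_mul_mem_PsiR {ε R r₁ r₂ : ℝ} {x y : W ε} (hx : x ∈ PsiR ε r₁) (hy : y ∈ PsiR ε r₂) :
    rho ε R (x * y) ∈ PsiR ε (r₂ + r₁) :=
  mem_PsiR.mpr ⟨rho_mem _ _ _, by rw [adK0_rho, adK0_mul_of_mem hx hy, map_smul]⟩

theorem one_mem_PsiR_zero (ε : ℝ) : (1 : W ε) ∈ PsiR ε 0 :=
  mem_PsiR_zero.mpr ⟨by rw [mem_Psi_iff, symbol_one]; simp [lap_apply], adK0_one ε⟩

/-! ## Conjugation and the sesquilinear form -/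

theorem symBasis_induction {ε : ℝ} {p : W ε → Prop} (basis : ∀ m, p (symBasis ε m))
    (add : ∀ x y, p x → p y → p (x + y)) (smul : ∀ (c : ℂ) x, p x → p (c • x)) (w : W ε) : p w := by
  have hw : w ∈ Submodule.span ℂ (Set.range (symBasis ε)) := by
    rw [(symBasis ε).span_eq]; trivial
  induction hw using Submodule.span_induction with
  | mem x h => obtain ⟨m, rfl⟩ := h; exact basis m
  | zero => simpa using smul 0 _ (basis 0)
  | add x y _ _ hx hy => exact add _ _ hx hy
  | smul c x _ hx => exact smul _ _ hx

theorem dagger_smul (ε : ℝ) (c : ℂ) (x : W ε) :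
    dagger ε (c • x) = starRingEnd ℂ c • dagger ε x := map_smulₛₗ _ _ _

theorem dagger_word (ε : ℝ) (l : List Gen) :
    dagger ε (toW ε (word l)) = toW ε (word (l.map Gen.conj).reverse) := by
  induction l with
  | nil => simpa [word] using dagger_scalar ε 1
  | cons g l ih =>
    have h : dagger ε (toW ε (letter g)) = toW ε (letter g.conj) := dagger_gen ε g
    rw [word_cons, map_mul, dagger_mul, ih, h, List.map_cons, List.reverse_cons, word_append,
      map_mul]
    simp [word]

theorem map_conj_map_conj (m : Multiset Gen) : (m.map Gen.conj).map Gen.conj = m := by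
  rw [Multiset.map_map]
  simp [Gen.conj_conj]

/-- Reversing and conjugating words permutes the rearrangements onto those of the conjugate
multiset. -/
theorem dagger_symBasis (ε : ℝ) (m : Multiset Gen) :
    dagger ε (symBasis ε m) = symBasis ε (m.map Gen.conj) := by
  rw [symBasis_apply, symBasis_apply, symPoly, symPoly, map_sum, map_sum, map_sum]
  refine Finset.sum_nbij' (fun l => (l.map Gen.conj).reverse) (fun l => (l.map Gen.conj).reverse)
    ?_ ?_ ?_ ?_ ?_
  · intro l hl
    rw [mem_symPoly] at *
    rw [Multiset.coe_reverse, ← Multiset.map_coe, hl]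
  · intro l hl
    rw [mem_symPoly] at *
    rw [Multiset.coe_reverse, ← Multiset.map_coe, hl, map_conj_map_conj]
  · intro l _
    simp [Function.comp_def, Gen.conj_conj]
  · intro l _
    simp [Function.comp_def, Gen.conj_conj]
  · intro l _
    exact dagger_word ε l

theorem dagger_dagger (ε : ℝ) (x : W ε) : dagger ε (dagger ε x) = x := by
  induction x using symBasis_induction with
  | basis m => rw [dagger_symBasis, dagger_symBasis, map_conj_map_conj]
  | add x y hx hy => rw [map_add, map_add, hx, hy]
  | smul c x hx => rw [dagger_smul, dagger_smul, hx, Complex.conj_conj]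

theorem Gen.conj_injective : Function.Injective Gen.conj :=
  Function.LeftInverse.injective Gen.conj_conj

theorem tr_dagger (ε : ℝ) (x : W ε) : tr ε (dagger ε x) = dagger ε (tr ε x) := by
  induction x using symBasis_induction with
  | basis m =>
    rw [dagger_symBasis, tr_symBasis, tr_symBasis, map_sum]
    symm
    refine Finset.sum_nbij' Gen.conj Gen.conj (by simp) (by simp)
      (fun g _ => Gen.conj_conj g) (fun g _ => Gen.conj_conj g) fun g _ => ?_
    have h1 : g.conj ∈ m.map Gen.conj ↔ g ∈ m := Multiset.mem_map_of_injective Gen.conj_injective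
    rw [← Multiset.map_erase _ Gen.conj_injective, ← Multiset.map_erase _ Gen.conj_injective]
    simp only [h1, Multiset.mem_map_of_injective Gen.conj_injective]
    split_ifs
    · rw [dagger_symBasis]
    · rw [map_zero]
  | add x y hx hy => simp only [map_add, hx, hy]
  | smul c x hx => simp only [dagger_smul, map_smul, hx]

theorem dagger_mem_Psi {ε : ℝ} {x : W ε} (hx : x ∈ Psi ε) : dagger ε x ∈ Psi ε := by
  rw [Psi, LinearMap.mem_ker] at *
  rw [tr_dagger, hx, map_zero]

theorem adK0_symBasis (ε : ℝ) (m : Multiset Gen) :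
    adK0 ε (symBasis ε m) = ((m.map Gen.sign).sum / 2) • symBasis ε m :=
  Module.Basis.constr_basis _ _ _ _

theorem conj_sum_sign (m : Multiset Gen) :
    ((m.map Gen.conj).map Gen.sign).sum = -starRingEnd ℂ (m.map Gen.sign).sum := by
  induction m using Multiset.induction with
  | empty => simp
  | cons g m ih =>
    have h : starRingEnd ℂ g.sign = g.sign := by cases g <;> simp [Gen.sign]
    simp only [Multiset.map_cons, Multiset.sum_cons, ih, Gen.sign_conj, map_add, h]
    ring

theorem adK0_dagger (ε : ℝ) (x : W ε) : adK0 ε (dagger ε x) = -dagger ε (adK0 ε x) := by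
  induction x using symBasis_induction with
  | basis m =>
    rw [dagger_symBasis, adK0_symBasis, adK0_symBasis, dagger_smul, dagger_symBasis,
      conj_sum_sign, ← neg_smul]
    congr 1
    simp [neg_div, map_ofNat]
  | add x y hx hy => simp only [map_add, hx, hy, neg_add]
  | smul c x hx => simp only [dagger_smul, map_smul, hx, smul_neg]

theorem dagger_mem_PsiR {ε r : ℝ} {x : W ε} (hx : x ∈ PsiR ε r) : dagger ε x ∈ PsiR ε (-r) := by
  rw [mem_PsiR] at *
  refine ⟨dagger_mem_Psi hx.1, ?_⟩
  rw [adK0_dagger, hx.2, dagger_smul]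
  simp

theorem dagger_kShift (ε R : ℝ) : dagger ε (kShift ε R) = kShift ε R := by
  simp only [kShift, K0, map_sub, dagger_smul, map_add, dagger_mul, dagger_gen, dagger_scalar,
    Gen.conj, Complex.conj_ofReal]
  simp [map_ofNat]

/-- † preserves Ψ, fixes K₀ - R̂ and reverses products, so it interchanges the two kernels. -/
theorem dagger_rho (ε R : ℝ) (w : W ε) : dagger ε (rho ε R w) = rhoStar ε R (dagger ε w) := by
  obtain ⟨u, hu⟩ := exists_eq_rho_add ε R w
  symm
  apply rhoStar_eq_of_mem (dagger_mem_Psi (rho_mem ε R w))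
  refine ⟨dagger ε u, ?_⟩
  change kShift ε R * dagger ε u = _
  rw [← map_sub, sub_eq_of_eq_add' hu, dagger_mul, dagger_kShift]

theorem adK0_rhoStar (ε R : ℝ) (w : W ε) : adK0 ε (rhoStar ε R w) = rhoStar ε R (adK0 ε w) := by
  have h := dagger_rho ε R (dagger ε w)
  rw [dagger_dagger] at h
  have h2 := dagger_rho ε R (dagger ε (adK0 ε w))
  rw [dagger_dagger] at h2
  rw [← h, ← h2, adK0_dagger, adK0_rho, adK0_dagger, map_neg, map_neg,
    neg_neg]

theorem pi0_symBasis (ε : ℝ) (m : Multiset Gen) :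
    pi0 ε (symBasis ε m) = if m = 0 then 1 else 0 := by
  rw [pi0, Module.Basis.coord_apply, Module.Basis.repr_self, Finsupp.single_apply]

theorem pi0_adK0 (ε : ℝ) (x : W ε) : pi0 ε (adK0 ε x) = 0 := by
  induction x using symBasis_induction with
  | basis m =>
    rw [adK0_symBasis, map_smul, pi0_symBasis]
    split_ifs with h
    · simp [h]
    · simp
  | add x y hx hy => simp only [map_add, hx, hy, add_zero]
  | smul c x hx => simp only [map_smul, hx, smul_zero]

theorem pi0_dagger (ε : ℝ) (x : W ε) : pi0 ε (dagger ε x) = starRingEnd ℂ (pi0 ε x) := by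
  induction x using symBasis_induction with
  | basis m =>
    rw [dagger_symBasis, pi0_symBasis, pi0_symBasis]
    simp only [Multiset.map_eq_zero]
    split_ifs <;> simp
  | add x y hx hy => simp only [map_add, hx, hy]
  | smul c x hx => simp only [dagger_smul, map_smul, hx, smul_eq_mul, map_mul]

/-- In weight zero the two projections agree. In any other weight both images have no constant term,
since both projections respect the grading. -/
theorem pi0_rhoStar (ε R : ℝ) (w : W ε) : pi0 ε (rhoStar ε R w) = pi0 ε (rho ε R w) := by
  induction w using symBasis_induction with
  | basis m =>
    by_cases hs : (m.map Gen.sign).sum / 2 = 0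
    · rw [rhoStar_eq_rho]
      rw [adK0_symBasis, hs, zero_smul]
    · have h1 := pi0_adK0 ε (rho ε R (symBasis ε m))
      have h2 := pi0_adK0 ε (rhoStar ε R (symBasis ε m))
      rw [adK0_rho, adK0_symBasis, map_smul, map_smul, smul_eq_zero] at h1
      rw [adK0_rhoStar, adK0_symBasis, map_smul, map_smul, smul_eq_zero] at h2
      rw [h1.resolve_left hs, h2.resolve_left hs]
  | add x y hx hy => simp only [map_add, hx, hy]
  | smul c x hx => simp only [map_smul, hx]

theorem sesqForm_apply (ε R : ℝ) (ξ ζ : Psi ε) :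
    sesqForm ε R ξ ζ = pi0 ε (rho ε R (dagger ε (ξ : W ε) * (ζ : W ε))) := rfl

theorem sesqForm_hermitian (ε R : ℝ) (ξ ζ : Psi ε) :
    sesqForm ε R ξ ζ = starRingEnd ℂ (sesqForm ε R ζ ξ) := by
  rw [sesqForm_apply, sesqForm_apply, ← pi0_dagger, dagger_rho, dagger_mul, dagger_dagger,
    pi0_rhoStar]

end FuzzySphere
end

noncomputable section
namespace FuzzySphere
open MvPolynomial (X pderiv monomial coeff)

/-! ## The fuzzy sphere relations in `𝒲(ε)` -/

theorem symbol_gen (ε : ℝ) (g : Gen) : symbol ε (gen ε g) = X g := by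
  have := symbol_gen_mul ε g 1
  rw [mul_one, symbol_one] at this
  rw [this]
  simp [actGen_apply]

/-- The elements `J₊, J₋, J₀` of `𝒲(ε)`. -/
def jGen (ε : ℝ) : SGen → W ε
  | .p => Jp ε
  | .m => Jm ε
  | .z => J0 ε

theorem adK0_jGen (ε : ℝ) (g : SGen) : adK0 ε (jGen ε g) = 0 := by
  have h : ∀ g h : Gen, g.sign + h.sign = 0 → adK0 ε (gen ε g * gen ε h) = 0 :=
    fun _ _ => adK0_gen_mul_gen ε
  cases g
  · exact h _ _ (by simp [Gen.sign])
  · exact h _ _ (by simp [Gen.sign])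
  · simp only [jGen, J0, map_smul, map_sub]
    rw [h _ _ (by simp [Gen.sign]), h _ _ (by simp [Gen.sign]), sub_zero, smul_zero]

theorem jGen_mem_PsiR_zero (ε : ℝ) (g : SGen) : jGen ε g ∈ PsiR ε 0 := by
  refine mem_PsiR_zero.mpr ⟨?_, adK0_jGen ε g⟩
  rw [mem_Psi_iff]
  cases g <;>
  simp only [jGen, Jp, Jm, J0, map_smul, map_sub, symbol_gen_mul, symbol_gen, actGen_apply,
    lap_apply, Derivation.leibniz, pderiv_X_apply, Gen.conj, map_zero, if_true, if_false,
    reduceCtorEq, smul_eq_mul, mul_zero, mul_one, add_zero, zero_add, Derivation.map_one_eq_zero,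
    smul_zero, sub_zero, sub_self]

theorem J0_mul_Jp (ε : ℝ) :
    J0 ε * Jp ε - Jp ε * J0 ε = (ε : ℂ) • Jp ε := by
  apply (symbol ε).injective
  simp only [Jp, J0, smul_mul_assoc, sub_mul, mul_smul_comm, mul_sub,
    mul_add, mul_assoc, map_smul, map_sub, map_add, symbol_gen_mul, symbol_gen, actGen_apply,
    Derivation.leibniz, pderiv_X_apply, Gen.conj, if_true, if_false, reduceCtorEq, smul_eq_mul,
    mul_zero, mul_one, Gen.sign, Derivation.map_one_eq_zero, map_zero]
  algebra

theorem J0_mul_Jm (ε : ℝ) :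
    J0 ε * Jm ε - Jm ε * J0 ε = -(ε : ℂ) • Jm ε := by
  apply (symbol ε).injective
  simp only [Jm, J0, smul_mul_assoc, sub_mul, mul_smul_comm, mul_sub,
    mul_add, mul_assoc, map_smul, map_sub, map_add, symbol_gen_mul, symbol_gen, actGen_apply,
    Derivation.leibniz, pderiv_X_apply, Gen.conj, if_true, if_false, reduceCtorEq, smul_eq_mul,
    mul_zero, mul_one, Gen.sign, Derivation.map_one_eq_zero, map_zero]
  algebra

theorem Jp_mul_Jm (ε : ℝ) :
    Jp ε * Jm ε - Jm ε * Jp ε = (2 * ε : ℂ) • J0 ε := by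
  apply (symbol ε).injective
  simp only [Jp, Jm, J0, mul_add, mul_assoc, map_smul, map_sub, map_add, symbol_gen_mul, symbol_gen, actGen_apply,
    Derivation.leibniz, pderiv_X_apply, Gen.conj, if_true, if_false, reduceCtorEq, smul_eq_mul,
    mul_zero, mul_one, Gen.sign, map_zero]
  algebra

/-- Schwinger's oscillator realization: the quadratic Casimir element depends only on the total
number operator. The identity is verified on Weyl symbols. -/
theorem casimir_eq_K0_sq (ε : ℝ) :
    J0 ε * J0 ε + (1 / 2 : ℂ) • (Jp ε * Jm ε) + (1 / 2 : ℂ) • (Jm ε * Jp ε) =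
      K0 ε * K0 ε - ((ε : ℂ) ^ 2 / 4) • 1 := by
  apply (symbol ε).injective
  simp only [Jp, Jm, J0, K0, Algebra.algebraMap_eq_smul_one, one_mul, symbol_one,
    smul_mul_assoc, sub_mul, add_mul, mul_smul_comm, mul_sub, mul_add, mul_assoc, map_smul, map_sub, map_add, symbol_gen_mul, symbol_gen, actGen_apply,
    Derivation.leibniz, pderiv_X_apply, Gen.conj, if_true, if_false, reduceCtorEq, smul_eq_mul,
    mul_zero, mul_one, Gen.sign, Derivation.map_one_eq_zero, map_zero]
  algebra

end FuzzySphere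
end

noncomputable section
namespace FuzzySphere
open MvPolynomial (X pderiv monomial coeff)

/-! ## The homomorphism from `𝒫(ε,R)` to `Ψ₀` -/

theorem Rhat_sq (ε R : ℝ) : (Rhat ε R : ℂ) ^ 2 = (R : ℂ) ^ 2 + (ε : ℂ) ^ 2 / 4 := by
  have : Rhat ε R ^ 2 = R ^ 2 + ε ^ 2 / 4 := Real.sq_sqrt (by positivity)
  exact_mod_cast congrArg (fun x : ℝ => (x : ℂ)) this

/-- R̂² = R² + ε²/4 is exactly what makes K₀² - ε²/4 - R² factor through K₀ - R̂; this explains the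
choice of R̂. -/
theorem casimir_eq (ε R : ℝ) :
    J0 ε * J0 ε + (1 / 2 : ℂ) • (Jp ε * Jm ε) + (1 / 2 : ℂ) • (Jm ε * Jp ε) =
      (K0 ε + algebraMap ℂ (W ε) (Rhat ε R : ℂ)) * kShift ε R + ((R : ℂ) ^ 2) • 1 := by
  have h : ((ε : ℂ) ^ 2 / 4) • (1 : W ε) =
      algebraMap ℂ (W ε) (Rhat ε R : ℂ) * algebraMap ℂ (W ε) (Rhat ε R : ℂ) -
        ((R : ℂ) ^ 2) • 1 := by
    rw [← map_mul, ← pow_two, Rhat_sq, map_add, Algebra.algebraMap_eq_smul_one,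
      Algebra.algebraMap_eq_smul_one]
    abel
  rw [casimir_eq_K0_sq, h, kShift, add_mul, mul_sub, mul_sub,
    Algebra.commutes (Rhat ε R : ℂ) (K0 ε)]
  abel

/-- The homomorphism of the free algebra in `J₊, J₋, J₀` into `𝒲(ε)`. -/
def freeToW (ε : ℝ) : FreeAlgebra ℂ SGen →ₐ[ℂ] W ε := FreeAlgebra.lift ℂ (jGen ε)

theorem freeToW_ι (ε : ℝ) (g : SGen) : freeToW ε (.ι ℂ g) = jGen ε g := by
  rw [freeToW, FreeAlgebra.lift_ι_apply]

/-- The operator `f ↦ ρ(J f)` on `Ψ₀`, for a generator `J`. -/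
def jAct (ε R : ℝ) (g : SGen) : Module.End ℂ (PsiR ε 0) :=
  (rho ε R ∘ₗ LinearMap.mulLeft ℂ (jGen ε g)).restrict fun f hf => by
    have := rho_mul_mem_PsiR (R := R) (jGen_mem_PsiR_zero ε g) hf
    rwa [add_zero] at this

theorem jAct_apply (ε R : ℝ) (g : SGen) (f : PsiR ε 0) :
    (jAct ε R g f : W ε) = rho ε R (jGen ε g * f) := rfl

/-- Iterated applications of ρ collapse into a single one by `rho_mul_rho`, so the relations can be
tested inside 𝒲. -/
theorem freeAct_apply (ε R : ℝ) (x : FreeAlgebra ℂ SGen) (f : PsiR ε 0) :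
    (FreeAlgebra.lift ℂ (jAct ε R) x f : W ε) = rho ε R (freeToW ε x * f) := by
  induction x using FreeAlgebra.induction generalizing f with
  | grade0 r =>
    rw [AlgHom.commutes, AlgHom.commutes, Module.algebraMap_end_apply, ← Algebra.smul_def, map_smul,
      rho_of_mem (mem_PsiR.mp f.2).1]
    rfl
  | grade1 g => rw [FreeAlgebra.lift_ι_apply, freeToW_ι, jAct_apply]
  | mul x y hx hy => rw [map_mul, Module.End.mul_apply, hx, hy, rho_mul_rho, map_mul (freeToW ε), mul_assoc]
  | add x y hx hy =>
    rw [map_add, LinearMap.add_apply, Submodule.coe_add, hx, hy, map_add, add_mul, map_add]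

theorem freeAct_rel (ε R : ℝ) ⦃x y : FreeAlgebra ℂ SGen⦄ (h : SRel ε R x y) :
    FreeAlgebra.lift ℂ (jAct ε R) x = FreeAlgebra.lift ℂ (jAct ε R) y := by
  ext f
  rw [freeAct_apply, freeAct_apply]
  cases h with
  | zp => simp only [map_sub, map_mul, map_smul, freeToW_ι, jGen, J0_mul_Jp]
  | zm => simp only [map_sub, map_mul, map_smul, freeToW_ι, jGen, J0_mul_Jm]
  | pm => simp only [map_sub, map_mul, map_smul, freeToW_ι, jGen, Jp_mul_Jm]
  | cas =>
    simp only [map_add, map_mul, map_smul, freeToW_ι, jGen, AlgHom.commutes, pow_two]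
    -- K₀ - R̂ moves to the right past the weight-zero f, where ρ annihilates it.
    rw [casimir_eq ε R, add_mul, mul_assoc, mul_kShift_comm R (mem_PsiR_zero.mp f.2).2, ← mul_assoc,
      map_add, rho_mul_kShift, zero_add, Algebra.algebraMap_eq_smul_one, pow_two]
    simp only [smul_mul_assoc, one_mul, smul_smul]

/-- The quotient map onto `𝒫(ε,R)`. -/
def toP (ε R : ℝ) : FreeAlgebra ℂ SGen →ₐ[ℂ] P ε R := RingQuot.mkAlgHom ℂ (SRel ε R)

theorem toP_surjective (ε R : ℝ) : Function.Surjective (toP ε R) :=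
  RingQuot.mkAlgHom_surjective ℂ (SRel ε R)

/-- The representation of `𝒫(ε,R)` on `Ψ₀`. -/
def pAct (ε R : ℝ) : P ε R →ₐ[ℂ] Module.End ℂ (PsiR ε 0) :=
  RingQuot.liftAlgHom ℂ ⟨FreeAlgebra.lift ℂ (jAct ε R), freeAct_rel ε R⟩

theorem pAct_toP (ε R : ℝ) (x : FreeAlgebra ℂ SGen) :
    pAct ε R (toP ε R x) = FreeAlgebra.lift ℂ (jAct ε R) x :=
  RingQuot.liftAlgHom_mkAlgHom_apply ℂ _ (freeAct_rel ε R) x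

/-- The canonical map from `𝒫(ε,R)` to `Ψ₀`. -/
def pToPsi (ε R : ℝ) : P ε R →ₗ[ℂ] PsiR ε 0 :=
  LinearMap.applyₗ (⟨1, one_mem_PsiR_zero ε⟩ : PsiR ε 0) ∘ₗ (pAct ε R).toLinearMap

theorem pToPsi_toP (ε R : ℝ) (x : FreeAlgebra ℂ SGen) :
    (pToPsi ε R (toP ε R x) : W ε) = rho ε R (freeToW ε x) := by
  have : pToPsi ε R (toP ε R x) = pAct ε R (toP ε R x) ⟨1, one_mem_PsiR_zero ε⟩ := rfl
  rw [this, pAct_toP, freeAct_apply, mul_one]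

theorem adK0_freeToW (ε : ℝ) (x : FreeAlgebra ℂ SGen) : adK0 ε (freeToW ε x) = 0 := by
  induction x using FreeAlgebra.induction with
  | grade0 r => rw [AlgHom.commutes, adK0_algebraMap]
  | grade1 g => rw [freeToW_ι, adK0_jGen]
  | mul x y hx hy => rw [map_mul, adK0_mul, hx, hy, zero_mul, mul_zero, add_zero]
  | add x y hx hy => rw [map_add, map_add, hx, hy, add_zero]

/-- The inner ρ on the right may always be dropped, the one on the left because the remaining right
factor has weight zero. -/
theorem pToPsi_mul (ε R : ℝ) (x y : P ε R) :
    (pToPsi ε R (x * y) : W ε) = rho ε R ((pToPsi ε R x : W ε) * pToPsi ε R y) := by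
  obtain ⟨x, rfl⟩ := toP_surjective ε R x
  obtain ⟨y, rfl⟩ := toP_surjective ε R y
  rw [← map_mul, pToPsi_toP, pToPsi_toP, pToPsi_toP, rho_mul_rho,
    rho_rho_mul _ (adK0_freeToW ε y), map_mul]

theorem pToPsi_one (ε R : ℝ) : (pToPsi ε R 1 : W ε) = 1 := by
  rw [← map_one (toP ε R), pToPsi_toP, map_one, rho_of_mem (mem_PsiR.mp (one_mem_PsiR_zero ε)).1]

theorem pToPsi_pGen (ε R : ℝ) (g : SGen) : (pToPsi ε R (pGen ε R g) : W ε) = jGen ε g := by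
  have : pGen ε R g = toP ε R (.ι ℂ g) := rfl
  rw [this, pToPsi_toP, freeToW_ι, rho_of_mem (mem_PsiR.mp (jGen_mem_PsiR_zero ε g)).1]

/-! ## Leading symbols -/

/-- The Weyl symbol of `w` is `f` up to terms of degree less than `n`, and `f` has degree at most
`n`. -/
def HasTop {ε : ℝ} (w : W ε) (f : Poly) (n : ℕ) : Prop :=
  f ∈ degLT (n + 1) ∧ symbol ε w - f ∈ degLT n

namespace HasTop

variable {ε : ℝ} {w w' : W ε} {f f' : Poly} {n : ℕ}

theorem sub (h : HasTop w f n) (h' : HasTop w' f' n) : HasTop (w - w') (f - f') n := by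
  refine ⟨sub_mem h.1 h'.1, ?_⟩
  have := sub_mem h.2 h'.2
  rwa [sub_sub_sub_comm, ← map_sub] at this

theorem smul (c : ℂ) (h : HasTop w f n) : HasTop (c • w) (c • f) n := by
  refine ⟨Submodule.smul_mem _ _ h.1, ?_⟩
  rw [map_smul, ← smul_sub]
  exact Submodule.smul_mem _ _ h.2

/-- The ε-correction is a derivative and therefore only affects lower degrees. -/
theorem gen_mul (g : Gen) (h : HasTop w f n) : HasTop (gen ε g * w) (X g * f) (n + 1) := by
  refine ⟨X_mul_mem_degLT g h.1, ?_⟩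
  have hw : symbol ε w ∈ degLT (n + 1) := by
    have := add_mem (degLT_mono (Nat.le_succ n) h.2) h.1
    rwa [sub_add_cancel] at this
  have e : symbol ε (gen ε g * w) - X g * f =
      X g * (symbol ε w - f) - ((ε : ℂ) / 2 * g.sign) • pderiv g.conj (symbol ε w) := by
    rw [symbol_gen_mul, actGen_apply]
    ring
  rw [e]
  exact sub_mem (X_mul_mem_degLT g h.2) (Submodule.smul_mem _ _
    (degLT_mono (Nat.le_succ n) (pderiv_mem_degLT _ hw)))

end HasTop

theorem hasTop_one (ε : ℝ) : HasTop (1 : W ε) 1 0 := by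
  refine ⟨?_, by rw [symbol_one, sub_self]; exact zero_mem _⟩
  have : (1 : Poly) = monomial 0 1 := rfl
  rw [this]
  exact monomial_mem_degLT (by simp) 1

/-- The symbols of `J₊, J₋, J₀`. -/
def jSymb : SGen → Poly
  | .p => X .ap * X .bm
  | .m => X .am * X .bp
  | .z => (1 / 2 : ℂ) • (X .ap * X .am - X .bp * X .bm)

theorem HasTop.jGen_mul {ε : ℝ} {w : W ε} {f : Poly} {n : ℕ} (g : SGen) (h : HasTop w f n) :
    HasTop (jGen ε g * w) (jSymb g * f) (n + 2) := by
  have key : ∀ g h' : Gen, HasTop (gen ε g * gen ε h' * w) (X g * X h' * f) (n + 2) := by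
    intro g h'
    rw [mul_assoc, mul_assoc]
    exact (h.gen_mul h').gen_mul g
  cases g
  · exact key _ _
  · exact key _ _
  · have := ((key .ap .am).sub (key .bp .bm)).smul (1 / 2)
    rwa [← sub_mul, ← sub_mul, ← smul_mul_assoc, ← smul_mul_assoc] at this

theorem HasTop.jGen_pow_mul {ε : ℝ} {w : W ε} {f : Poly} {n : ℕ} (g : SGen) (h : HasTop w f n)
    (i : ℕ) : HasTop (jGen ε g ^ i * w) (jSymb g ^ i * f) (n + 2 * i) := by
  induction i with
  | zero => simpa using h
  | succ i ih =>
    rw [pow_succ', pow_succ', mul_assoc, mul_assoc]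
    exact ih.jGen_mul g

/-! ## Surjectivity -/

theorem rho_jGen_mul_mem {ε R : ℝ} (g : SGen) {x : W ε}
    (hx : rho ε R x ∈ LinearMap.range ((PsiR ε 0).subtype ∘ₗ pToPsi ε R)) :
    rho ε R (jGen ε g * x) ∈ LinearMap.range ((PsiR ε 0).subtype ∘ₗ pToPsi ε R) := by
  obtain ⟨y, hy⟩ := hx
  refine ⟨pGen ε R g * y, ?_⟩
  change (pToPsi ε R y : W ε) = _ at hy
  change (pToPsi ε R (pGen ε R g * y) : W ε) = _
  rw [pToPsi_mul, pToPsi_pGen, hy, rho_mul_rho]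

/-- Under ρ, left multiplication of weight-zero elements by K₀ is the scalar R̂, which is how K₀
disappears from the generating set. -/
theorem rho_K0_mul {ε R : ℝ} {x : W ε} (hx : adK0 ε x = 0) :
    rho ε R (K0 ε * x) = (Rhat ε R : ℂ) • rho ε R x := by
  have h : K0 ε * x = x * kShift ε R + (Rhat ε R : ℂ) • x := by
    rw [← mul_kShift_comm R hx, kShift, sub_mul, ← Algebra.smul_def]
    abel
  rw [h, map_add, rho_mul_kShift, zero_add, map_smul]

/-- A raising letter times a lowering letter is J₊, J₋ or K₀ ± J₀ - ε/2. -/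
theorem rho_gen_mul_gen_mul_mem {ε R : ℝ} {g h : Gen} (hg : g = .ap ∨ g = .bp)
    (hh : h = .am ∨ h = .bm) {x : W ε} (hx₀ : adK0 ε x = 0)
    (hx : rho ε R x ∈ LinearMap.range ((PsiR ε 0).subtype ∘ₗ pToPsi ε R)) :
    rho ε R (gen ε g * gen ε h * x) ∈ LinearMap.range ((PsiR ε 0).subtype ∘ₗ pToPsi ε R) := by
  set Q := LinearMap.range ((PsiR ε 0).subtype ∘ₗ pToPsi ε R)
  have hK : rho ε R (K0 ε * x) ∈ Q := by
    rw [rho_K0_mul hx₀]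
    exact Submodule.smul_mem _ _ hx
  have hJ : ∀ g, rho ε R (jGen ε g * x) ∈ Q := fun g => rho_jGen_mul_mem g hx
  have e₁ : gen ε .ap * gen ε .am = K0 ε + J0 ε - ((ε : ℂ) / 2) • 1 := by
    rw [K0, J0, Algebra.algebraMap_eq_smul_one]
    module
  have e₂ : gen ε .bp * gen ε .bm = K0 ε - J0 ε - ((ε : ℂ) / 2) • 1 := by
    rw [K0, J0, Algebra.algebraMap_eq_smul_one]
    module
  rcases hg with rfl | rfl <;> rcases hh with rfl | rfl
  · rw [e₁, sub_mul, add_mul, smul_mul_assoc, one_mul, map_sub, map_add, map_smul]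
    exact sub_mem (add_mem hK (hJ .z)) (Submodule.smul_mem _ _ hx)
  · exact hJ .p
  · rw [show gen ε .bp * gen ε .am = gen ε .am * gen ε .bp by
      rw [gen_comm]; simp [Gen.conj]]
    exact hJ .m
  · rw [e₂, sub_mul, sub_mul, smul_mul_assoc, one_mul, map_sub, map_sub, map_smul]
    exact sub_mem (sub_mem hK (hJ .z)) (Submodule.smul_mem _ _ hx)

theorem exists_gen_mem {m : Multiset Gen} (hm : m ≠ 0) (hs : (m.map Gen.sign).sum = 0) :
    ∃ (g h : Gen) (k : Multiset Gen),
      (g = .ap ∨ g = .bp) ∧ (h = .am ∨ h = .bm) ∧ m = g ::ₘ h ::ₘ k := by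
  have hc : (m.count .ap : ℂ) + m.count .bp = m.count .am + m.count .bm := by
    rw [← wt_toFinsupp, wt, sum_gen] at hs
    simp only [Gen.sign, Multiset.toFinsupp_apply] at hs
    linear_combination hs
  have hc' : m.count .ap + m.count .bp = m.count .am + m.count .bm := by exact_mod_cast hc
  have hpos : 0 < m.card := Multiset.card_pos.mpr hm
  have hcard : ∑ g : Gen, m.count g = m.card :=
    Multiset.sum_count_eq_card (s := Finset.univ) (m := m) (by simp)
  rw [sum_gen] at hcard
  have h₁ : ∃ g : Gen, (g = .ap ∨ g = .bp) ∧ 0 < m.count g := by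
    by_contra! h
    have h1 := h .ap (Or.inl rfl)
    have h2 := h .bp (Or.inr rfl)
    omega
  have h₂ : ∃ g : Gen, (g = .am ∨ g = .bm) ∧ 0 < m.count g := by
    by_contra! h
    have h1 := h .am (Or.inl rfl)
    have h2 := h .bm (Or.inr rfl)
    omega
  obtain ⟨g, hg, hgm⟩ := h₁
  obtain ⟨h, hh, hhm⟩ := h₂
  obtain ⟨k, rfl⟩ := Multiset.exists_cons_of_mem (Multiset.count_pos.mp hgm)
  have hgh : h ≠ g := by rcases hg with rfl | rfl <;> rcases hh with rfl | rfl <;> simp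
  have hk : h ∈ k := (Multiset.mem_cons.mp (Multiset.count_pos.mp hhm)).resolve_left hgh
  obtain ⟨k, rfl⟩ := Multiset.exists_cons_of_mem hk
  exact ⟨g, h, k, hg, hh, rfl⟩

theorem mono_cons (g : Gen) (m : Multiset Gen) : mono (g ::ₘ m) = X g * mono m := by
  have := X_mul_mono_erase (Multiset.mem_cons_self g m)
  rw [← this, Multiset.erase_cons_head]

theorem mono_mem_degLT {m : Multiset Gen} {n : ℕ} (h : m.card < n) : mono m ∈ degLT n :=
  monomial_mem_degLT (by rwa [degree_toFinsupp]) 1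

theorem hasTop_symm_mono (ε : ℝ) (m : Multiset Gen) :
    HasTop ((symbol ε).symm (mono m)) (mono m) m.card := by
  refine ⟨mono_mem_degLT (Nat.lt_succ_self _), ?_⟩
  rw [LinearEquiv.apply_symm_apply, sub_self]
  exact zero_mem _

theorem adK0_symm {ε : ℝ} {f : Poly} (hf : wtOp f = 0) : adK0 ε ((symbol ε).symm f) = 0 := by
  apply (symbol ε).injective
  rw [symbol_adK0, LinearEquiv.apply_symm_apply, hf, smul_zero, map_zero]

theorem wtOp_symbol {ε : ℝ} {x : W ε} (hx : adK0 ε x = 0) : wtOp (symbol ε x) = 0 := by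
  have := symbol_adK0 ε x
  rw [hx, map_zero] at this
  exact (smul_eq_zero.mp this.symm).resolve_left (by norm_num)

/-- Induction on degree. A weight-zero monomial other than 1 contains a raising and a lowering
letter; peeling them off leaves a weight-zero monomial of lower degree. -/
theorem rho_symm_mem (ε R : ℝ) (n : ℕ) : ∀ f ∈ degLT n, wtOp f = 0 →
    rho ε R ((symbol ε).symm f) ∈ LinearMap.range ((PsiR ε 0).subtype ∘ₗ pToPsi ε R) := by
  set Q := LinearMap.range ((PsiR ε 0).subtype ∘ₗ pToPsi ε R) with hQ
  induction n with
  | zero =>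
    intro f hf _
    rw [eq_zero_of_mem_degLT_zero hf, map_zero, map_zero]
    exact zero_mem _
  | succ n ih =>
    have key : ∀ m : Multiset Gen, m.card ≤ n → (m.map Gen.sign).sum = 0 →
        rho ε R ((symbol ε).symm (mono m)) ∈ Q := by
      intro m hm hs
      rcases Nat.lt_or_ge m.card n with hlt | hge
      · exact ih _ (mono_mem_degLT hlt) (by rw [wtOp_mono, hs, zero_smul])
      by_cases h0 : m = 0
      · subst h0
        have : (symbol ε).symm (mono 0) = 1 := by
          apply (symbol ε).injective
          rw [LinearEquiv.apply_symm_apply, symbol_one]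
          simp [mono]
        rw [this]
        refine ⟨1, ?_⟩
        rw [rho_of_mem (mem_PsiR.mp (one_mem_PsiR_zero ε)).1]
        exact pToPsi_one ε R
      obtain ⟨g, h, k, hg, hh, rfl⟩ := exists_gen_mem h0 hs
      have hgh : g.sign + h.sign = 0 := by
        rcases hg with rfl | rfl <;> rcases hh with rfl | rfl <;> simp [Gen.sign]
      have hk : (k.map Gen.sign).sum = 0 := by
        simp only [Multiset.map_cons, Multiset.sum_cons] at hs
        linear_combination hs - hgh
      simp only [Multiset.card_cons] at hm hge
      have hk₀ : wtOp (mono k) = 0 := by rw [wtOp_mono, hk, zero_smul]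
      have hxk : adK0 ε ((symbol ε).symm (mono k)) = 0 := adK0_symm hk₀
      have hx : adK0 ε (gen ε g * gen ε h * (symbol ε).symm (mono k)) = 0 := by
        rw [adK0_mul, adK0_gen_mul_gen ε hgh, hxk, zero_mul, mul_zero, add_zero]
      have hmem := rho_gen_mul_gen_mul_mem hg hh hxk (ih (mono k) (mono_mem_degLT (by omega)) hk₀)
      have htop := ((hasTop_symm_mono ε k).gen_mul h).gen_mul g
      rw [← mul_assoc, ← mono_cons, ← mono_cons] at htop
      -- The noncommutative product has the required monomial as leading symbol, and the error is
      -- again of weight zero and of lower degree.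
      have hd := ih _ (degLT_mono (by omega) htop.2) (by
        rw [map_sub, wtOp_symbol hx, wtOp_mono, hs, zero_smul, sub_zero])
      rw [map_sub, map_sub, LinearEquiv.symm_apply_apply] at hd
      have := sub_mem hmem hd
      rwa [sub_sub_cancel] at this
    intro f hf hw
    rw [f.as_sum, map_sum, map_sum]
    refine Submodule.sum_mem _ fun d hd => ?_
    have hd' := MvPolynomial.mem_support_iff.mp hd
    have hdeg : d.degree ≤ n := by
      by_contra h
      exact hd' (hf d (by omega))
    have hwt : wt d = 0 := by
      have := congrArg (coeff d) hw
      rw [coeff_wtOp, MvPolynomial.coeff_zero] at this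
      exact (mul_eq_zero.mp this).resolve_right hd'
    obtain ⟨m, rfl⟩ := Multiset.toFinsupp.surjective d
    have e : monomial (Multiset.toFinsupp m) (coeff (Multiset.toFinsupp m) f) =
        coeff (Multiset.toFinsupp m) f • mono m := by
      rw [mono, MvPolynomial.smul_monomial, smul_eq_mul, mul_one]
    rw [e, map_smul, map_smul]
    rw [degree_toFinsupp] at hdeg
    rw [wt_toFinsupp] at hwt
    exact Submodule.smul_mem _ _ (key m hdeg hwt)

theorem pToPsi_surjective (ε R : ℝ) : Function.Surjective (pToPsi ε R) := by
  intro x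
  obtain ⟨hx, hx₀⟩ := mem_PsiR_zero.mp x.2
  obtain ⟨n, hn⟩ := exists_mem_degLT (symbol ε (x : W ε))
  obtain ⟨y, hy⟩ := rho_symm_mem ε R n _ hn (wtOp_symbol hx₀)
  rw [LinearEquiv.symm_apply_apply, rho_of_mem hx] at hy
  exact ⟨y, Subtype.ext hy⟩

end FuzzySphere
end

noncomputable section
namespace FuzzySphere

/-! ## A spanning set of `𝒫(ε,R)` -/

/-- The powers `J₊ⁱ` and `J₋ⁱ⁺¹`, in the free algebra. -/
def ladder : ℕ ⊕ ℕ → FreeAlgebra ℂ SGen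
  | .inl i => .ι ℂ .p ^ i
  | .inr i => .ι ℂ .m ^ (i + 1)

section Relations

variable (ε R : ℝ)

theorem toP_ι (g : SGen) : toP ε R (.ι ℂ g) = pGen ε R g := rfl

theorem toP_rel {x y : FreeAlgebra ℂ SGen} (h : SRel ε R x y) : toP ε R x = toP ε R y :=
  RingQuot.mkAlgHom_rel ℂ h

theorem pGen_rel_zp : pGen ε R .z * pGen ε R .p - pGen ε R .p * pGen ε R .z =
    (ε : ℂ) • pGen ε R .p := by
  have := toP_rel ε R (SRel.zp)
  simpa only [map_sub, map_mul, map_smul, toP_ι] using this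

theorem pGen_rel_zm : pGen ε R .z * pGen ε R .m - pGen ε R .m * pGen ε R .z =
    -(ε : ℂ) • pGen ε R .m := by
  have := toP_rel ε R (SRel.zm)
  simpa only [map_sub, map_mul, map_smul, toP_ι] using this

theorem pGen_rel_pm : pGen ε R .p * pGen ε R .m - pGen ε R .m * pGen ε R .p =
    (2 * ε : ℂ) • pGen ε R .z := by
  have := toP_rel ε R (SRel.pm)
  simpa only [map_sub, map_mul, map_smul, toP_ι] using this

theorem pGen_rel_cas : pGen ε R .z ^ 2 + (1 / 2 : ℂ) • (pGen ε R .p * pGen ε R .m) +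
    (1 / 2 : ℂ) • (pGen ε R .m * pGen ε R .p) = ((R : ℂ) ^ 2) • 1 := by
  have := toP_rel ε R (SRel.cas)
  rw [AlgHom.commutes, Algebra.algebraMap_eq_smul_one] at this
  rw [← this]
  simp only [map_add, map_mul, map_smul, map_pow, toP_ι]

open Polynomial in
-- The commutator and Casimir relations fix the difference and the sum of J₊J₋ and J₋J₊, so each
-- product is a polynomial in J₀.
theorem pGen_p_mul_m : pGen ε R .p * pGen ε R .m =
    aeval (pGen ε R .z) (C ((R : ℂ) ^ 2) - X ^ 2 + C (ε : ℂ) * X) := by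
  have h1 := pGen_rel_pm ε R
  have h2 := pGen_rel_cas ε R
  rw [sub_eq_iff_eq_add'] at h1
  simp only [map_add, map_sub, map_mul, aeval_C, map_pow (aeval _) X, aeval_X]
  rw [Algebra.algebraMap_eq_smul_one, Algebra.algebraMap_eq_smul_one, smul_mul_assoc, one_mul, ← h2]
  rw [h1]
  module

open Polynomial in
theorem pGen_m_mul_p : pGen ε R .m * pGen ε R .p =
    aeval (pGen ε R .z) (C ((R : ℂ) ^ 2) - X ^ 2 - C (ε : ℂ) * X) := by
  have h1 := pGen_rel_pm ε R
  have h2 := pGen_rel_cas ε R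
  rw [sub_eq_iff_eq_add'] at h1
  simp only [map_sub, map_mul, aeval_C, map_pow (aeval _) X, aeval_X]
  rw [Algebra.algebraMap_eq_smul_one, Algebra.algebraMap_eq_smul_one, smul_mul_assoc, one_mul, ← h2]
  rw [h1]
  module

open Polynomial in
-- An eigenvector a of [z, ·] moves past polynomials in z at the cost of shifting their argument.
theorem mul_aeval_of_mul_eq {A : Type*} [Ring A] [Algebra ℂ A] {a z : A} {c : ℂ}
    (h : z * a - a * z = c • a) (f : ℂ[X]) :
    a * aeval z f = aeval z (f.comp (X - C c)) * a := by
  have h' : a * z = (z - algebraMap ℂ A c) * a := by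
    rw [sub_mul, ← Algebra.smul_def, ← h]; abel
  have hs : SemiconjBy a z (z - algebraMap ℂ A c) := h'
  rw [aeval_comp, map_sub, aeval_X, aeval_C]
  induction f using Polynomial.induction_on' with
  | add p q hp hq => rw [map_add, map_add, mul_add, add_mul, hp, hq]
  | monomial n b =>
    rw [aeval_monomial, aeval_monomial, ← mul_assoc, ← Algebra.commutes, mul_assoc,
      (hs.pow_right n).eq, mul_assoc]

/-- The span of the elements `f(J₀) J₊ⁱ` and `f(J₀) J₋ⁱ`. -/
def normalSpan : Submodule ℂ (P ε R) :=
  Submodule.span ℂ {x | ∃ (f : Polynomial ℂ) (l : ℕ ⊕ ℕ),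
    x = Polynomial.aeval (pGen ε R .z) f * toP ε R (ladder l)}

open Polynomial in
theorem aeval_mul_mem_normalSpan (f : ℂ[X]) {x : P ε R} (hx : x ∈ normalSpan ε R) :
    aeval (pGen ε R .z) f * x ∈ normalSpan ε R := by
  induction hx using Submodule.span_induction with
  | mem x h =>
    obtain ⟨f', l, rfl⟩ := h
    rw [← mul_assoc, ← map_mul]
    exact Submodule.subset_span ⟨_, _, rfl⟩
  | zero => rw [mul_zero]; exact zero_mem _
  | add x y _ _ hx hy => rw [mul_add]; exact add_mem hx hy
  | smul c x _ hx => rw [mul_smul_comm]; exact Submodule.smul_mem _ _ hx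

theorem ladder_mem_normalSpan (l : ℕ ⊕ ℕ) : toP ε R (ladder l) ∈ normalSpan ε R :=
  Submodule.subset_span ⟨1, l, by rw [map_one, one_mul]⟩

theorem pow_m_mem_normalSpan (i : ℕ) : pGen ε R .m ^ i ∈ normalSpan ε R := by
  cases i with
  | zero => simpa [ladder] using ladder_mem_normalSpan ε R (.inl 0)
  | succ i => simpa [ladder, toP_ι] using ladder_mem_normalSpan ε R (.inr i)

theorem pow_p_mem_normalSpan (i : ℕ) : pGen ε R .p ^ i ∈ normalSpan ε R := by
  simpa [ladder, toP_ι] using ladder_mem_normalSpan ε R (.inl i)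

/-- A ladder generator passes the polynomial in J₀ and then either lengthens the ladder or meets an
opposite generator, and such a pair is a polynomial in J₀. -/
theorem pGen_mul_mem_normalSpan (g : SGen) {x : P ε R} (hx : x ∈ normalSpan ε R) :
    pGen ε R g * x ∈ normalSpan ε R := by
  induction hx using Submodule.span_induction with
  | zero => rw [mul_zero]; exact zero_mem _
  | add x y _ _ hx hy => rw [mul_add]; exact add_mem hx hy
  | smul c x _ hx => rw [mul_smul_comm]; exact Submodule.smul_mem _ _ hx
  | mem x h =>
    obtain ⟨f, l, rfl⟩ := h
    cases g with
    | z =>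
      have := aeval_mul_mem_normalSpan ε R (Polynomial.X * f) (ladder_mem_normalSpan ε R l)
      rwa [map_mul, Polynomial.aeval_X, mul_assoc] at this
    | p =>
      rw [← mul_assoc, mul_aeval_of_mul_eq (pGen_rel_zp ε R), mul_assoc]
      apply aeval_mul_mem_normalSpan
      cases l with
      | inl i =>
        have := pow_p_mem_normalSpan ε R (i + 1)
        simpa [ladder, toP_ι, pow_succ'] using this
      | inr i =>
        rw [ladder, map_pow, toP_ι, pow_succ', ← mul_assoc, pGen_p_mul_m]
        exact aeval_mul_mem_normalSpan ε R _ (pow_m_mem_normalSpan ε R i)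
    | m =>
      rw [← mul_assoc, mul_aeval_of_mul_eq (pGen_rel_zm ε R), mul_assoc]
      apply aeval_mul_mem_normalSpan
      cases l with
      | inl i =>
        rw [ladder, map_pow, toP_ι]
        cases i with
        | zero =>
          have := pow_m_mem_normalSpan ε R 1
          simpa using this
        | succ i =>
          rw [pow_succ', ← mul_assoc, pGen_m_mul_p]
          exact aeval_mul_mem_normalSpan ε R _ (pow_p_mem_normalSpan ε R i)
      | inr i =>
        have := pow_m_mem_normalSpan ε R (i + 2)
        rw [ladder, map_pow, toP_ι, ← pow_succ']
        exact this

theorem normalSpan_eq_top : normalSpan ε R = ⊤ := by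
  rw [eq_top_iff]
  rintro x -
  obtain ⟨x, rfl⟩ := toP_surjective ε R x
  have key : ∀ y ∈ normalSpan ε R, toP ε R x * y ∈ normalSpan ε R := by
    induction x using FreeAlgebra.induction with
    | grade0 r =>
      intro y hy
      rw [AlgHom.commutes, ← Algebra.smul_def]
      exact Submodule.smul_mem _ _ hy
    | grade1 g => exact fun y hy => pGen_mul_mem_normalSpan ε R g hy
    | mul a b ha hb =>
      intro y hy
      rw [map_mul, mul_assoc]
      exact ha _ (hb _ hy)
    | add a b ha hb =>
      intro y hy
      rw [map_add, add_mul]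
      exact add_mem (ha _ hy) (hb _ hy)
  have h1 : (1 : P ε R) ∈ normalSpan ε R := by
    simpa using pow_p_mem_normalSpan ε R 0
  simpa using key 1 h1

/-- The elements `J₀ʲ J₊ⁱ` and `J₀ʲ J₋ⁱ⁺¹`, in the free algebra. -/
def normalWord (k : ℕ × (ℕ ⊕ ℕ)) : FreeAlgebra ℂ SGen := .ι ℂ .z ^ k.1 * ladder k.2

theorem span_normalWord :
    Submodule.span ℂ (Set.range fun k => toP ε R (normalWord k)) = ⊤ := by
  rw [eq_top_iff, ← normalSpan_eq_top, normalSpan, Submodule.span_le]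
  rintro _ ⟨f, l, rfl⟩
  rw [Polynomial.aeval_eq_sum_range, Finset.sum_mul]
  refine Submodule.sum_mem _ fun j _ => ?_
  rw [smul_mul_assoc]
  refine Submodule.smul_mem _ _ (Submodule.subset_span ⟨(j, l), ?_⟩)
  simp only [normalWord, map_mul, map_pow, toP_ι]

end Relations

end FuzzySphere

namespace FuzzySphere
open MvPolynomial (X pderiv monomial coeff)

/-! ## Injectivity -/

/-- The degree of the leading symbol of `normalWord k`. -/
def normalDeg : ℕ × (ℕ ⊕ ℕ) → ℕ
  | (j, .inl i) => 2 * i + 2 * j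
  | (j, .inr i) => 2 * (i + 1) + 2 * j

/-- The leading symbol of `normalWord k`. -/
def normalSymb : ℕ × (ℕ ⊕ ℕ) → Poly
  | (j, .inl i) => jSymb .z ^ j * jSymb .p ^ i
  | (j, .inr i) => jSymb .z ^ j * jSymb .m ^ (i + 1)

theorem hasTop_normalWord (ε : ℝ) (k : ℕ × (ℕ ⊕ ℕ)) :
    HasTop (freeToW ε (normalWord k)) (normalSymb k) (normalDeg k) := by
  have h : ∀ g i, HasTop (jGen ε g ^ i) (jSymb g ^ i) (2 * i) := by
    intro g i
    simpa using (hasTop_one ε).jGen_pow_mul g i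
  obtain ⟨j, i | i⟩ := k
  · have := (h .p i).jGen_pow_mul .z j
    simpa only [normalWord, ladder, normalSymb, normalDeg, map_mul, map_pow, freeToW_ι] using this
  · have := (h .m (i + 1)).jGen_pow_mul .z j
    simpa only [normalWord, ladder, normalSymb, normalDeg, map_mul, map_pow, freeToW_ι] using this

/-- A parametrization of the cone on which the quadratic form vanishes. -/
def conePoint : Gen → Poly
  | .ap => X .ap
  | .am => X .am
  | .bp => X .am
  | .bm => -X .ap

/-- The restriction of polynomials to the cone. -/
def toCone : Poly →ₐ[ℂ] Poly := MvPolynomial.aeval conePoint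

theorem toCone_X (g : Gen) : toCone (X g) = conePoint g := MvPolynomial.aeval_X _ _

theorem toCone_quad : toCone quad = 0 := by
  simp only [quad, map_add, map_mul, toCone_X, conePoint]
  ring

/-- The parametrization substitutes linear forms, so it cannot raise the degree. -/
theorem toCone_mono_mem_degLT (m : Multiset Gen) : toCone (mono m) ∈ degLT (m.card + 1) := by
  induction m using Multiset.induction with
  | empty =>
    have : mono 0 = 1 := by simp [mono]
    rw [this, map_one, ← this]
    exact mono_mem_degLT (by simp)
  | cons g m ih =>
    rw [mono_cons, map_mul, toCone_X, Multiset.card_cons]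
    cases g
    · exact X_mul_mem_degLT _ ih
    · exact X_mul_mem_degLT _ ih
    · rw [conePoint, neg_mul]
      exact neg_mem (X_mul_mem_degLT _ ih)
    · exact X_mul_mem_degLT _ ih

theorem toCone_mem_degLT {n : ℕ} {f : Poly} (hf : f ∈ degLT n) : toCone f ∈ degLT n := by
  rw [degLT_eq_span] at hf
  induction hf using Submodule.span_induction with
  | mem x h =>
    obtain ⟨d, hd, rfl⟩ := h
    obtain ⟨m, rfl⟩ := Multiset.toFinsupp.surjective d
    rw [Set.mem_ofPred_eq, degree_toFinsupp] at hd
    exact degLT_mono hd (toCone_mono_mem_degLT m)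
  | zero => rw [map_zero]; exact zero_mem _
  | add x y _ _ hx hy => rw [map_add]; exact add_mem hx hy
  | smul c x _ hx => rw [map_smul]; exact Submodule.smul_mem _ _ hx

/-- The exponent of the restriction of `normalSymb k` to the cone. -/
def coneExp : ℕ × (ℕ ⊕ ℕ) → Gen →₀ ℕ
  | (j, .inl i) => Finsupp.single .ap (j + 2 * i) + Finsupp.single .am j
  | (j, .inr i) => Finsupp.single .ap j + Finsupp.single .am (j + 2 * (i + 1))

/-- The difference of the exponents is 2i or -2(i + 1), which determines the ladder element, and the
smaller exponent is j. -/
theorem coneExp_injective : Function.Injective coneExp := by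
  rintro ⟨j, i | i⟩ ⟨j', i' | i'⟩ h
  all_goals
    have h1 := DFunLike.congr_fun h Gen.ap
    have h2 := DFunLike.congr_fun h Gen.am
    simp [coneExp] at h1 h2
  · obtain rfl := h2
    obtain rfl : i = i' := by omega
    rfl
  · omega
  · omega
  · obtain rfl := h1
    obtain rfl : i = i' := by omega
    rfl

theorem degree_coneExp (k : ℕ × (ℕ ⊕ ℕ)) : (coneExp k).degree = normalDeg k := by
  obtain ⟨j, i | i⟩ := k <;> simp only [coneExp, normalDeg, map_add, Finsupp.degree_single] <;> ring

/-- With x and y for the two parameters, J₀, J₊, J₋ restrict to xy, -x², y², so every normal word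
yields a single monomial. -/
theorem toCone_normalSymb (k : ℕ × (ℕ ⊕ ℕ)) :
    ∃ c : ℂ, c ≠ 0 ∧ toCone (normalSymb k) = monomial (coneExp k) c := by
  have hz : toCone (jSymb .z) = X .ap * X .am := by
    simp only [jSymb, map_smul, map_sub, map_mul, toCone_X, conePoint]
    algebra
  have hp : toCone (jSymb .p) = -X .ap ^ 2 := by
    simp only [jSymb, map_mul, toCone_X, conePoint]
    ring
  have hm : toCone (jSymb .m) = X .am ^ 2 := by
    simp only [jSymb, map_mul, toCone_X, conePoint]
    ring
  have hmon : ∀ a b : ℕ, ∀ c : ℂ,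
      monomial (Finsupp.single Gen.ap a + Finsupp.single Gen.am b) c =
        c • (X .ap ^ a * X .am ^ b : Poly) := by
    intro a b c
    rw [MvPolynomial.X_pow_eq_monomial, MvPolynomial.X_pow_eq_monomial,
      MvPolynomial.monomial_mul, MvPolynomial.smul_monomial]
    simp
  obtain ⟨j, i | i⟩ := k
  · refine ⟨(-1) ^ i, pow_ne_zero _ (by norm_num), ?_⟩
    rw [normalSymb, map_mul, map_pow, map_pow, hz, hp, coneExp, hmon, neg_pow,
      MvPolynomial.smul_eq_C_mul, map_pow, map_neg, map_one]
    ring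
  · refine ⟨1, one_ne_zero, ?_⟩
    rw [normalSymb, map_mul, map_pow, map_pow, hz, hm, coneExp, hmon, one_smul]
    ring

/-- If ρ kills the combination, it is a multiple of K₀ - R̂, so its part of top degree is divisible
by q and vanishes on the cone. There the leading symbols are nonzero multiples of distinct
monomials. -/
theorem eq_zero_of_rho_sum_normalWord {ε R : ℝ} (v : ℕ × (ℕ ⊕ ℕ) →₀ ℂ)
    (h : rho ε R (v.sum fun k c => c • freeToW ε (normalWord k)) = 0) : v = 0 := by
  by_contra hne
  obtain ⟨k₀, hk₀, hmax⟩ := v.support.exists_max_image normalDeg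
    (Finsupp.support_nonempty_iff.mpr hne)
  set n := normalDeg k₀ with hn
  obtain ⟨u, hu⟩ := exists_eq_rho_add ε R (v.sum fun k c => c • freeToW ε (normalWord k))
  rw [h, zero_add] at hu
  have hu' := congrArg (symbol ε) hu
  rw [symbol_mul_kShift] at hu'
  set U := symbol ε u
  have htop : ∀ k ∈ v.support, normalSymb k ∈ degLT (n + 1) ∧
      symbol ε (freeToW ε (normalWord k)) - normalSymb k ∈ degLT n := by
    intro k hk
    have := hasTop_normalWord ε k
    exact ⟨degLT_mono (Nat.succ_le_succ (hmax k hk)) this.1, degLT_mono (hmax k hk) this.2⟩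
  set F := ∑ k ∈ v.support, v k • normalSymb k with hF
  have hF₁ : F ∈ degLT (n + 1) :=
    Submodule.sum_mem _ fun k hk => Submodule.smul_mem _ _ (htop k hk).1
  have hF₂ : (1 / 2 : ℂ) • perturbedQuad (lowerOp ε R (-1 / 2)) U - F ∈ degLT n := by
    rw [← hu', Finsupp.sum, map_sum, hF, ← Finset.sum_sub_distrib]
    refine Submodule.sum_mem _ fun k hk => ?_
    rw [map_smul, ← smul_sub]
    exact Submodule.smul_mem _ _ (htop k hk).2
  -- This bound ensures that the lower-order operator contributes nothing in degree n, so that only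
  -- q·U matters there.
  have hU : U ∈ degLT n := by
    apply mem_degLT_of_lap_perturbedQuad_mem (admissible_lowerOp ε R (-1 / 2))
    have h1 : perturbedQuad (lowerOp ε R (-1 / 2)) U ∈ degLT (n + 1) := by
      have := add_mem (degLT_mono (Nat.le_succ n) hF₂) hF₁
      rw [sub_add_cancel] at this
      exact (Submodule.smul_mem_iff _ (by norm_num)).mp this
    exact degLT_mono (by omega) (lap_mem_degLT h1)
  have hD : F - (1 / 2 : ℂ) • (quad * U) ∈ degLT n := by
    have := sub_mem (Submodule.smul_mem _ (1 / 2 : ℂ)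
      ((admissible_lowerOp ε R (-1 / 2)).mem_degLT n U hU)) hF₂
    rw [perturbedQuad_apply] at this
    convert this using 1
    module
  -- The exponent of `k₀` has degree exactly n, so its coefficient must vanish; injectivity of the
  -- exponents isolates the term of `k₀`.
  have hcone := toCone_mem_degLT hD (coneExp k₀) (by rw [degree_coneExp])
  rw [map_sub, map_smul, map_mul, toCone_quad, zero_mul, smul_zero, sub_zero, hF, map_sum,
    MvPolynomial.coeff_sum, Finset.sum_eq_single k₀] at hcone
  · obtain ⟨c, hc, he⟩ := toCone_normalSymb k₀
    rw [map_smul, he, MvPolynomial.coeff_smul, MvPolynomial.coeff_monomial, if_pos rfl,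
      smul_eq_mul] at hcone
    exact (mul_ne_zero (Finsupp.mem_support_iff.mp hk₀) hc) hcone
  · intro k _ hk
    obtain ⟨c, -, he⟩ := toCone_normalSymb k
    rw [map_smul, he, MvPolynomial.coeff_smul, MvPolynomial.coeff_monomial,
      if_neg fun h => hk (coneExp_injective h), smul_zero]
  · exact fun h => absurd hk₀ h

theorem pToPsi_injective (ε R : ℝ) : Function.Injective (pToPsi ε R) := by
  rw [injective_iff_map_eq_zero]
  intro x hx
  have hx' : x ∈ Submodule.span ℂ (Set.range fun k => toP ε R (normalWord k)) := by
    rw [span_normalWord]; trivial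
  rw [Finsupp.mem_span_range_iff_exists_finsupp] at hx'
  obtain ⟨v, rfl⟩ := hx'
  have e : (v.sum fun k c => c • toP ε R (normalWord k)) =
      toP ε R (v.sum fun k c => c • normalWord k) := by
    simp only [Finsupp.sum, map_sum, map_smul]
  rw [e] at hx ⊢
  have h : (pToPsi ε R (toP ε R (v.sum fun k c => c • normalWord k)) : W ε) = 0 := by
    rw [hx]; rfl
  rw [pToPsi_toP] at h
  have : v = 0 := by
    apply eq_zero_of_rho_sum_normalWord (ε := ε) (R := R)
    simpa only [Finsupp.sum, map_sum, map_smul] using h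
  rw [this]
  simp

/-- The isomorphism of `𝒫(ε,R)` with `Ψ₀`. -/
def pEquivPsi (ε R : ℝ) : P ε R ≃ₗ[ℂ] PsiR ε 0 :=
  LinearEquiv.ofBijective (pToPsi ε R) ⟨pToPsi_injective ε R, pToPsi_surjective ε R⟩

end FuzzySphere
end

noncomputable section
namespace FuzzySphere
open MvPolynomial (X pderiv monomial coeff)

/-! ## Families which are Lipschitz at `ε = 0` -/

/-- A coefficient with `c ε = c 0 + O(ε)`. -/
def LipAtZero (c : ℝ → ℂ) : Prop := (fun ε => c ε - c 0) =O[𝓝 0] fun ε : ℝ => ε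

theorem lipAtZero_const (a : ℂ) : LipAtZero fun _ => a := by
  simpa [LipAtZero] using isBigO_zero _ _

theorem lipAtZero_ofReal : LipAtZero fun ε => (ε : ℂ) := by
  refine isBigO_of_le _ fun ε => ?_
  simp

theorem LipAtZero.mul {c d : ℝ → ℂ} (hc : LipAtZero c) (hd : LipAtZero d) :
    LipAtZero fun ε => c ε * d ε := by
  have hid : (fun ε : ℝ => ε) =O[𝓝 0] fun _ => (1 : ℝ) :=
    (continuous_id.tendsto 0).isBigO_one ℝ
  have hd₁ : (fun ε => d ε) =O[𝓝 0] fun _ => (1 : ℝ) := by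
    have := (hd.trans hid).add (isBigO_const_const (d 0) (one_ne_zero' ℝ) (𝓝 0))
    simpa using this
  have h₁ := IsBigO.mul hc hd₁
  simp only [mul_one] at h₁
  have h := h₁.add (hd.const_mul_left (c 0))
  refine h.congr_left fun ε => ?_
  ring

/-- From R ≤ R̂ ≤ R + |ε|. For R = 0 one has R̂ = |ε|/2, which is not differentiable; hence the
condition c(0) + O(ε) on coefficients in place of smoothness. -/
theorem lipAtZero_Rhat {R : ℝ} (hR : 0 ≤ R) : LipAtZero fun ε => (Rhat ε R : ℂ) := by
  refine isBigO_of_le _ fun ε => ?_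
  have h0 : Rhat 0 R = R := by simp [Rhat, Real.sqrt_sq hR]
  have h1 : R ≤ Rhat ε R := Real.le_sqrt_of_sq_le (by nlinarith [sq_nonneg ε])
  have h2 : Rhat ε R ≤ R + |ε| := by
    refine Real.sqrt_le_iff.mpr ⟨by positivity, ?_⟩
    nlinarith [sq_abs ε, sq_nonneg ε, mul_nonneg hR (abs_nonneg ε)]
  beta_reduce
  rw [h0, ← Complex.ofReal_sub, Complex.norm_real, Real.norm_eq_abs, Real.norm_eq_abs,
    abs_of_nonneg (by linarith)]
  linarith

/-- Families of polynomials which are finite sums `∑ cᵢ(ε) vᵢ` with `cᵢ(ε) = cᵢ(0) + O(ε)`. -/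
inductive LipFamily : (ℝ → Poly) → Prop
  | smul_const (c : ℝ → ℂ) (v : Poly) (hc : LipAtZero c) : LipFamily fun ε => c ε • v
  | add (F G : ℝ → Poly) (hF : LipFamily F) (hG : LipFamily G) : LipFamily fun ε => F ε + G ε

namespace LipFamily

theorem const (v : Poly) : LipFamily fun _ => v := by
  simpa using smul_const _ v (lipAtZero_const 1)

theorem smul {c : ℝ → ℂ} (hc : LipAtZero c) {F : ℝ → Poly} (hF : LipFamily F) :
    LipFamily fun ε => c ε • F ε := by
  induction hF with
  | smul_const d v hd => simpa only [mul_smul] using smul_const _ v (hc.mul hd)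
  | add F G _ _ hF hG => simpa only [smul_add] using add _ _ hF hG

theorem sub {F G : ℝ → Poly} (hF : LipFamily F) (hG : LipFamily G) :
    LipFamily fun ε => F ε - G ε := by
  have := add _ _ hF (smul (lipAtZero_const (-1)) hG)
  simpa only [neg_one_smul, ← sub_eq_add_neg] using this

/-- Because families are finite sums of scalar functions times fixed polynomials, a linear operator
depending on ε need only be tested on fixed polynomials. -/
theorem map {T : ℝ → Poly →ₗ[ℂ] Poly} (hT : ∀ v, LipFamily fun ε => T ε v) {F : ℝ → Poly}
    (hF : LipFamily F) : LipFamily fun ε => T ε (F ε) := by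
  induction hF with
  | smul_const c v hc => simpa only [map_smul] using smul hc (hT v)
  | add F G _ _ hF hG => simpa only [map_add] using add _ _ hF hG

end LipFamily

/-! ### The size of a Weyl symbol -/

/-- The sum of the absolute values of the coefficients in the basis `S(s,t,u,v)`. -/
def symbolNorm (f : Poly) : ℝ := (symbolBasis.repr f).sum fun _ c => ‖c‖

/-- The symbol carries the bases of all 𝒲(ε) to one fixed basis, so sizes for different ε are
compared in a single space. -/
theorem coordNorm_eq (ε : ℝ) (w : W ε) : coordNorm ε w = symbolNorm (symbol ε w) := by
  have : symbolBasis.repr (symbol ε w) = (symBasis ε).repr w := by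
    simp [symbol, Module.Basis.equiv]
  rw [coordNorm, symbolNorm, this]

theorem symbolNorm_nonneg (f : Poly) : 0 ≤ symbolNorm f :=
  Finset.sum_nonneg fun _ _ => norm_nonneg _

theorem symbolNorm_eq_sum (f : Poly) {s : Finset (Multiset Gen)}
    (hs : (symbolBasis.repr f).support ⊆ s) :
    symbolNorm f = ∑ m ∈ s, ‖symbolBasis.repr f m‖ :=
  Finsupp.sum_of_support_subset _ hs _ fun _ _ => norm_zero

theorem symbolNorm_add_le (f g : Poly) : symbolNorm (f + g) ≤ symbolNorm f + symbolNorm g := by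
  classical
  set s := (symbolBasis.repr f).support ∪ (symbolBasis.repr g).support
  rw [symbolNorm_eq_sum f (s := s) Finset.subset_union_left,
    symbolNorm_eq_sum g (s := s) Finset.subset_union_right,
    symbolNorm_eq_sum (f + g) (s := s) (by rw [map_add]; exact Finsupp.support_add),
    ← Finset.sum_add_distrib]
  refine Finset.sum_le_sum fun m _ => ?_
  rw [map_add, Finsupp.add_apply]
  exact norm_add_le _ _

theorem symbolNorm_smul (c : ℂ) (f : Poly) : symbolNorm (c • f) = ‖c‖ * symbolNorm f := by
  rw [symbolNorm_eq_sum (c • f) (s := (symbolBasis.repr f).support)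
    (by rw [map_smul]; exact Finsupp.support_smul), symbolNorm_eq_sum f subset_rfl, Finset.mul_sum]
  refine Finset.sum_congr rfl fun m _ => ?_
  rw [map_smul, Finsupp.smul_apply, smul_eq_mul, norm_mul]

theorem LipFamily.isBigO_sub {F : ℝ → Poly} (hF : LipFamily F) :
    (fun ε => symbolNorm (F ε - F 0)) =O[𝓝 0] fun ε : ℝ => ε := by
  induction hF with
  | smul_const c v hc =>
    simp only [← sub_smul, symbolNorm_smul, mul_comm _ (symbolNorm v)]
    exact (IsBigO.norm_left hc).const_mul_left _
  | add F G _ _ hF hG =>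
    refine (isBigO_of_le _ fun ε => ?_).trans (hF.add hG)
    rw [Real.norm_of_nonneg (symbolNorm_nonneg _),
      Real.norm_of_nonneg (add_nonneg (symbolNorm_nonneg _) (symbolNorm_nonneg _)),
      add_sub_add_comm]
    exact symbolNorm_add_le _ _

/-! ## The products and projections as families in `ε` -/

/-- The product of `𝒲(ε)` on Weyl symbols. -/
def star (ε : ℝ) (f g : Poly) : Poly := symbol ε ((symbol ε).symm f * (symbol ε).symm g)

/-- The projection `ρ` on Weyl symbols. -/
def symbolRho (R ε : ℝ) : Poly →ₗ[ℂ] Poly :=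
  (symbol ε).toLinearMap ∘ₗ rho ε R ∘ₗ (symbol ε).symm.toLinearMap

theorem symbolRho_apply (R ε : ℝ) (f : Poly) :
    symbolRho R ε f = symbol ε (rho ε R ((symbol ε).symm f)) := rfl

theorem lipFamily_actGen (g : Gen) (v : Poly) : LipFamily fun ε => actGen ε g v := by
  have h : LipAtZero fun ε => (ε : ℂ) / 2 * g.sign := by
    have := lipAtZero_ofReal.mul (lipAtZero_const (g.sign / 2))
    simpa only [mul_div_assoc', div_mul_eq_mul_div] using this
  exact (LipFamily.const _).sub ((LipFamily.const (pderiv g.conj v)).smul h)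

theorem star_smul_left (ε : ℝ) (c : ℂ) (f g : Poly) : star ε (c • f) g = c • star ε f g := by
  simp [star]

theorem star_add_left (ε : ℝ) (f f' g : Poly) :
    star ε (f + f') g = star ε f g + star ε f' g := by
  simp [star, add_mul]

theorem star_actGen (ε : ℝ) (g : Gen) (f h : Poly) :
    star ε (actGen ε g f) h = actGen ε g (star ε f h) := by
  have : (symbol ε).symm (actGen ε g f) = gen ε g * (symbol ε).symm f := by
    rw [LinearEquiv.symm_apply_eq, symbol_gen_mul, LinearEquiv.apply_symm_apply]
  rw [star, star, this, mul_assoc, symbol_gen_mul]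

/-- Multiplication by a variable is the left operator of the letter plus a derivative term with
fewer letters; this gives a recursion for the product in its left factor. -/
theorem star_mono_cons (ε : ℝ) (g : Gen) (m : Multiset Gen) (h : Poly) :
    star ε (mono (g ::ₘ m)) h = actGen ε g (star ε (mono m) h) +
      ((ε : ℂ) * (g.sign / 2 * m.count g.conj)) • star ε (mono (m.erase g.conj)) h := by
  have : mono (g ::ₘ m) = actGen ε g (mono m) +
      ((ε : ℂ) * (g.sign / 2 * m.count g.conj)) • mono (m.erase g.conj) := by
    rw [actGen_apply, pderiv_mono, mono_cons]
    module
  rw [this, star_add_left, star_actGen, star_smul_left]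

theorem lipFamily_star_mono (m : Multiset Gen) (v : Poly) :
    LipFamily fun ε => star ε (mono m) v := by
  induction hn : m.card using Nat.strong_induction_on generalizing m with
  | _ n ih =>
  subst hn
  induction m using Multiset.induction with
  | empty =>
    have h : ∀ ε, (symbol ε).symm (mono 0) = 1 := by
      intro ε
      rw [LinearEquiv.symm_apply_eq, symbol_one]
      simp [mono]
    simpa only [star, h, one_mul, LinearEquiv.apply_symm_apply] using LipFamily.const v
  | cons g m _ =>
    simp only [star_mono_cons]
    have hm : m.card < (g ::ₘ m).card := by simp
    exact LipFamily.add _ _ ((ih _ hm m rfl).map (lipFamily_actGen g))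
      ((ih _ ((Multiset.card_erase_le).trans_lt hm) _ rfl).smul
        (lipAtZero_ofReal.mul (lipAtZero_const _)))

theorem lipFamily_star_const (f v : Poly) : LipFamily fun ε => star ε f v := by
  induction f using MvPolynomial.induction_on' with
  | monomial d a =>
    obtain ⟨m, rfl⟩ := Multiset.toFinsupp.surjective d
    have e : monomial (Multiset.toFinsupp m) a = a • mono m := by
      rw [mono, MvPolynomial.smul_monomial, smul_eq_mul, mul_one]
    simp only [e, star_smul_left]
    exact (lipFamily_star_mono m v).smul (lipAtZero_const a)
  | add p q hp hq => simpa only [star_add_left] using LipFamily.add _ _ hp hq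

theorem LipFamily.star {F G : ℝ → Poly} (hF : LipFamily F) (hG : LipFamily G) :
    LipFamily fun ε => star ε (F ε) (G ε) := by
  induction hF with
  | smul_const c v hc =>
    simp only [star_smul_left]
    refine LipFamily.smul hc ?_
    exact hG.map (T := fun ε => (symbol ε).toLinearMap ∘ₗ
      LinearMap.mulLeft ℂ ((symbol ε).symm v) ∘ₗ (symbol ε).symm.toLinearMap)
      (lipFamily_star_const v)
  | add F F' _ _ hF hF' => simpa only [star_add_left] using LipFamily.add _ _ hF hF'

theorem symbolRho_of_harmonic (R ε : ℝ) {h : Poly} (hh : lap h = 0) : symbolRho R ε h = h := by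
  rw [symbolRho_apply, rho_of_mem, LinearEquiv.apply_symm_apply]
  rw [mem_Psi_iff, LinearEquiv.apply_symm_apply, hh]

/-- ρ kills the multiples of K₀ - R̂, so a factor q may be traded for lower-order terms whose
coefficients are ε/2, ε²/4 and 2R̂. -/
theorem symbolRho_quad_mul (R ε : ℝ) (g : Poly) : symbolRho R ε (quad * g) =
    ((ε : ℂ) * (1 / 2)) • symbolRho R ε (wtOp g) +
      ((ε : ℂ) * ε * (1 / 4)) • symbolRho R ε (lap g) +
      ((Rhat ε R : ℂ) * 2) • symbolRho R ε g := by
  have h : symbolRho R ε ((1 / 2 : ℂ) • perturbedQuad (lowerOp ε R (-1 / 2)) g) = 0 := by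
    have e := symbol_mul_kShift ε R ((symbol ε).symm g)
    rw [LinearEquiv.apply_symm_apply] at e
    rw [symbolRho_apply, ← e, LinearEquiv.symm_apply_apply, rho_mul_kShift, map_zero]
  rw [map_smul, smul_eq_zero] at h
  have h' := h.resolve_left (by norm_num)
  rw [perturbedQuad_apply, lowerOp_apply, map_add, map_sub, map_sub, map_smul, map_smul,
    map_smul] at h'
  rw [eq_neg_of_add_eq_zero_left h']
  module

/-- Induction on degree: the unperturbed, hence ε-independent, Fischer decomposition v = h + q g has
h fixed by ρ, and the term q g reduces to lower degree by `symbolRho_quad_mul`. -/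
theorem lipFamily_symbolRho_const {R : ℝ} (hR : 0 ≤ R) (n : ℕ) :
    ∀ v ∈ degLT n, LipFamily fun ε => symbolRho R ε v := by
  induction n using Nat.strong_induction_on with
  | _ n ih =>
  intro v hv
  rcases Nat.eq_zero_or_pos n with rfl | hn
  · rw [eq_zero_of_mem_degLT_zero hv]
    simpa only [map_zero] using LipFamily.const 0
  obtain ⟨h, g, hh, hg, rfl⟩ := exists_harmonic_add_quad_mul hv
  simp only [map_add, symbolRho_of_harmonic R _ hh, symbolRho_quad_mul]
  have ih' := ih (n - 2) (by omega)
  have hε := lipAtZero_ofReal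
  refine LipFamily.add _ _ (LipFamily.const h) (LipFamily.add _ _ (LipFamily.add _ _ ?_ ?_) ?_)
  · exact (ih' _ (diagOp_mem_degLT _ hg)).smul (hε.mul (lipAtZero_const _))
  · exact (ih' _ (degLT_mono (Nat.sub_le _ _) (lap_mem_degLT hg))).smul
      ((hε.mul hε).mul (lipAtZero_const _))
  · exact (ih' _ hg).smul ((lipAtZero_Rhat hR).mul (lipAtZero_const _))

theorem LipFamily.symbolRho {R : ℝ} (hR : 0 ≤ R) {F : ℝ → Poly} (hF : LipFamily F) :
    LipFamily fun ε => symbolRho R ε (F ε) :=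
  hF.map fun v => by
    obtain ⟨n, hn⟩ := exists_mem_degLT v
    exact lipFamily_symbolRho_const hR n v hn

/-! ## The commutative limit -/

theorem W_zero_mul_comm (x y : W 0) : x * y = y * x := by
  have hg : ∀ (g : Gen) (y : W 0), gen 0 g * y = y * gen 0 g := by
    intro g y
    induction y using W_induction with
    | one => rw [one_mul, mul_one]
    | gen_mul h y ih =>
      have : gen 0 g * gen 0 h = gen 0 h * gen 0 g := by rw [gen_comm]; simp
      rw [← mul_assoc, this, mul_assoc, ih, mul_assoc]
    | add x y hx hy => rw [mul_add, add_mul, hx, hy]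
    | smul c x hx => rw [mul_smul_comm, smul_mul_assoc, hx]
  induction x using W_induction with
  | one => rw [one_mul, mul_one]
  | gen_mul h x ih => rw [mul_assoc, ih, ← mul_assoc, hg, mul_assoc]
  | add x x' hx hx' => rw [mul_add, add_mul, hx, hx']
  | smul c x hx => rw [mul_smul_comm, smul_mul_assoc, hx]

/-- For ε = 0 the algebra is commutative, so the harmless bracketing also holds on the other side.
-/
theorem rho_zero_rho_mul (R : ℝ) (x y : W 0) : rho 0 R (rho 0 R x * y) = rho 0 R (x * y) := by
  rw [W_zero_mul_comm, rho_mul_rho, W_zero_mul_comm]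

/-- The difference of the two bracketings is a family with coefficients c(0) + O(ε) whose value at ε
= 0 is zero. -/
theorem isBigO_rho_rho_mul {R : ℝ} (hR : 0 ≤ R) {F G : ℝ → Poly} (hF : LipFamily F)
    (hG : LipFamily G) :
    (fun ε : ℝ => coordNorm ε
      (rho ε R (rho ε R ((symbol ε).symm (F ε)) * (symbol ε).symm (G ε)) -
        rho ε R ((symbol ε).symm (F ε) * (symbol ε).symm (G ε)))) =O[𝓝 0] fun ε : ℝ => ε := by
  have h := (((hF.symbolRho hR).star hG).symbolRho hR).sub ((hF.star hG).symbolRho hR)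
  refine h.isBigO_sub.congr_left fun ε => ?_
  rw [coordNorm_eq]
  simp only [symbolRho_apply, star, LinearEquiv.symm_apply_apply, rho_zero_rho_mul, sub_self,
    sub_zero, map_sub]

theorem elt_eq (ε : ℝ) (v : Multiset Gen →₀ ℂ) :
    elt ε v = (symbol ε).symm (symbolBasis.repr.symm v) := by
  rw [LinearEquiv.eq_symm_apply]
  simp [elt, symbol, Module.Basis.equiv]

theorem isBigO_rho_rho_elt_mul {R : ℝ} (hR : 0 ≤ R) (v₁ v₂ : Multiset Gen →₀ ℂ) :
    (fun ε : ℝ => coordNorm ε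
      (rho ε R (rho ε R (elt ε v₁) * elt ε v₂) - rho ε R (elt ε v₁ * elt ε v₂)))
      =O[𝓝 0] fun ε : ℝ => ε := by
  simp only [elt_eq]
  exact isBigO_rho_rho_mul hR (LipFamily.const _) (LipFamily.const _)

theorem isBigO_rho_rho_elt_mul_elt_mul {R : ℝ} (hR : 0 ≤ R) (v₁ v₂ v₃ : Multiset Gen →₀ ℂ) :
    (fun ε : ℝ => coordNorm ε
      (rho ε R (rho ε R (elt ε v₁ * elt ε v₂) * elt ε v₃)
        - rho ε R (elt ε v₁ * elt ε v₂ * elt ε v₃))) =O[𝓝 0] fun ε : ℝ => ε := by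
  have h := isBigO_rho_rho_mul hR ((LipFamily.const (symbolBasis.repr.symm v₁)).star
    (LipFamily.const (symbolBasis.repr.symm v₂))) (LipFamily.const (symbolBasis.repr.symm v₃))
  simpa only [star, LinearEquiv.symm_apply_apply, ← elt_eq] using h

end FuzzySphere
end

/-! ### Assembly of the statements -/

theorem mainTheorem3 (R : ℝ) (hR : 0 ≤ R) :
    (∀ ε : ℝ, 0 < Rhat ε R →
      -- the projections exist
      IsCompl (Psi ε) (kerRho ε R) ∧ IsCompl (Psi ε) (kerRhoStar ε R) ∧
      -- the product on `Ψ₀`: closed, associative, unital, and equal to the product `ρ⋆`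
      (∀ f ∈ PsiR ε 0, ∀ g ∈ PsiR ε 0, rho ε R (f * g) ∈ PsiR ε 0) ∧
      (∀ f ∈ PsiR ε 0, ∀ g ∈ PsiR ε 0, ∀ h ∈ PsiR ε 0,
        rho ε R (rho ε R (f * g) * h) = rho ε R (f * rho ε R (g * h))) ∧
      ((1 : W ε) ∈ PsiR ε 0 ∧
        ∀ f ∈ PsiR ε 0, rho ε R (1 * f) = f ∧ rho ε R (f * 1) = f) ∧
      (∀ f ∈ PsiR ε 0, ∀ g ∈ PsiR ε 0, rho ε R (f * g) = rhoStar ε R (f * g)) ∧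
      -- isomorphism of `𝒫(ε,R)` with `(Ψ₀,ρ)` and with `(Ψ₀,ρ⋆)`
      (∃ e : P ε R ≃ₗ[ℂ] PsiR ε 0,
        (e 1 : W ε) = 1 ∧
        (∀ x y : P ε R, (e (x * y) : W ε) = rho ε R ((e x : W ε) * (e y : W ε))) ∧
        (∀ x y : P ε R, (e (x * y) : W ε) = rhoStar ε R ((e x : W ε) * (e y : W ε))) ∧
        (e (pGen ε R .z) : W ε) = J0 ε ∧
        (e (pGen ε R .p) : W ε) = Jp ε ∧
        (e (pGen ε R .m) : W ε) = Jm ε) ∧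
      -- the bracketing which is harmless in general
      (∀ w₁ w₂ : W ε, rho ε R (w₁ * rho ε R w₂) = rho ε R (w₁ * w₂)) ∧
      (∀ ξ₁ ∈ Psi ε, ∀ ξ₂ ∈ Psi ε, ∀ ξ₃ ∈ Psi ε,
        rho ε R (ξ₁ * rho ε R (ξ₂ * ξ₃)) = rho ε R (ξ₁ * ξ₂ * ξ₃)) ∧
      -- compatibility with the grading
      (∀ r : ℝ, ∀ ξ ∈ PsiR ε r, dagger ε ξ ∈ PsiR ε (-r)) ∧
      (∀ r₁ r₂ : ℝ, ∀ ξ ∈ PsiR ε r₁, ∀ ζ ∈ PsiR ε r₂, rho ε R (ξ * ζ) ∈ PsiR ε (r₂ + r₁)) ∧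
      -- `Ψ` and `Ψ_r` are right modules over `(Ψ₀,ρ)`
      (∀ ξ ∈ Psi ε, ∀ f ∈ PsiR ε 0, rho ε R (ξ * f) ∈ Psi ε) ∧
      (∀ r : ℝ, ∀ ξ ∈ PsiR ε r, ∀ f ∈ PsiR ε 0, rho ε R (ξ * f) ∈ PsiR ε r) ∧
      (∀ ξ ∈ Psi ε, rho ε R (ξ * 1) = ξ) ∧
      (∀ ξ ∈ Psi ε, ∀ f ∈ PsiR ε 0, ∀ g ∈ PsiR ε 0,
        rho ε R (rho ε R (ξ * f) * g) = rho ε R (ξ * rho ε R (f * g)) ∧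
        rho ε R (ξ * rho ε R (f * g)) = rho ε R (ξ * f * g)) ∧
      -- the sesquilinear form is Hermitian
      (∀ ξ ζ : Psi ε, sesqForm ε R ξ ζ = starRingEnd ℂ (sesqForm ε R ζ ξ))) ∧
    -- the other bracketing, for fixed symmetric polynomials and `ε → 0`
    (∀ v₁ v₂ : Multiset Gen →₀ ℂ,
      (fun ε : ℝ => coordNorm ε
        (rho ε R (rho ε R (elt ε v₁) * elt ε v₂) - rho ε R (elt ε v₁ * elt ε v₂)))
        =O[𝓝 0] fun ε : ℝ => ε) ∧
    (∀ v₁ v₂ v₃ : Multiset Gen →₀ ℂ,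
      (fun ε : ℝ => coordNorm ε
        (rho ε R (rho ε R (elt ε v₁ * elt ε v₂) * elt ε v₃)
          - rho ε R (elt ε v₁ * elt ε v₂ * elt ε v₃)))
        =O[𝓝 0] fun ε : ℝ => ε) := by
  refine ⟨fun ε _ => ⟨isCompl_kerRho ε R, isCompl_kerRhoStar ε R, ?_, ?_,
    ⟨one_mem_PsiR_zero ε, ?_⟩, ?_, ?_, rho_mul_rho ε R, ?_, fun r ξ hξ => dagger_mem_PsiR hξ,
    fun r₁ r₂ ξ hξ ζ hζ => rho_mul_mem_PsiR hξ hζ, fun ξ _ f _ => rho_mem _ _ _, ?_, ?_, ?_,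
    sesqForm_hermitian ε R⟩, isBigO_rho_rho_elt_mul hR, isBigO_rho_rho_elt_mul_elt_mul hR⟩
  · intro f hf g hg
    simpa using rho_mul_mem_PsiR (R := R) hf hg
  · intro f _ g _ h hh
    rw [rho_rho_mul _ (mem_PsiR_zero.mp hh).2, rho_mul_rho, mul_assoc]
  · intro f hf
    rw [one_mul, mul_one, rho_of_mem (mem_PsiR.mp hf).1]
    exact ⟨rfl, rfl⟩
  · intro f hf g hg
    rw [rhoStar_eq_rho]
    simpa using adK0_mul_of_mem hf hg
  · refine ⟨pEquivPsi ε R, pToPsi_one ε R, pToPsi_mul ε R, fun x y => ?_, pToPsi_pGen ε R .z,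
      pToPsi_pGen ε R .p, pToPsi_pGen ε R .m⟩
    -- The product of two elements of Ψ₀ in 𝒲 has weight zero, where ρ⋆ and ρ coincide; one map
    -- therefore serves both products.
    rw [rhoStar_eq_rho]
    · exact pToPsi_mul ε R x y
    · simpa using adK0_mul_of_mem (pEquivPsi ε R x).2 (pEquivPsi ε R y).2
  · intro ξ₁ _ ξ₂ _ ξ₃ _
    rw [rho_mul_rho, mul_assoc]
  · intro r ξ hξ f hf
    simpa using rho_mul_mem_PsiR (R := R) hξ hf
  · intro ξ hξ
    rw [mul_one, rho_of_mem hξ]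
  · intro ξ _ f _ g hg
    rw [rho_rho_mul _ (mem_PsiR_zero.mp hg).2, rho_mul_rho, mul_assoc]
    exact ⟨rfl, rfl⟩
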